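/- Conventions. A strict partition is a finite sequence $\lambda=(\lambda_1>\lambda_2>\dots>\lambda_\ell>0)$ of positive integers; put $\ell(\lambda)=\ell$ and $\lambda_1=0$ for $\lambda=\emptyset$. Its shifted diagram is $D_\lambda=\{(i,j)\mid 1\le i\le\ell(\lambda),\ i\le j\le i+\lambda_i-1\}$, with $(i,j)$ the box in row $i$ (counted from the top) and column $j$. Over the alphabet $1'<1<2'<2<\cdots$, a tableau of shape $D$ is a filling of the boxes of $D$ whose entries weakly increase along rows and down columns, such that each column contains each unmarked letter $k$ at most once and each row contains each marked letter $k'$ at most once. Let $Q_D=\sum_T x^{c(T)}$ be the generating function, in variables $x_1,x_2,\dots$, of all tableaux $T$ of shape $D$, where $c(T)_k$ is the number of entries of $T$ equal to $k$ or $k'$. For strict partitions $\lambda,\mu$ let $D_{\lambda/\mu}=D_\lambda\setminus D_\mu$ and $Q_{\lambda/\mu}=Q_{D_{\lambda/\mu}}$ if $D_\mu\subseteq D_\lambda$, and $Q_{\lambda/\mu}=0$ otherwise; $Q_\lambda=Q_{\lambda/\emptyset}=Q_{D_\lambda}$. Let $comp(D)$ be the number of edgewise connected components of $D$. The border of $\lambda$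 is $B_\lambda=\{(x,y)\in D_\lambda\mid (x+1,y+1)\notin D_\lambda\}$. A corner of $D_\lambda$ is a box $(x,y)\in D_\lambda$ with $(x+1,y),(x,y+1)\notin D_\lambda$. Statement. Let $\lambda$ be a strict partition. (1) For every integer $n$ with $1\le n\le\lambda_1$, $$Q_{\lambda/(n)}=\sum_{\nu}2^{comp(D_{\lambda/\nu})-1}\,Q_\nu,$$ the sum being over all strict partitions $\nu$ with $D_\nu\subseteq D_\lambda$, $D_{\lambda/\nu}\subseteq B_\lambda$ and $|D_{\lambda/\nu}|=n$. (2) If $\lambda_1\ge 2$, then $D_\lambda\setminus B_\lambda=D_\mu$ for a strict partition $\mu$. Let $B_\lambda^\times=\{(x,y)\in B_\lambda\mid (x-1,y)\notin B_\lambda\text{ and }(x,y-1)\notin B_\lambda\}$. For each $(x,y)\in B_\lambda^\times$ the set $D_\mu\cup\{(x,y)\}$ is the shifted diagram of a strict partition, and $$Q_{\lambda/(\lambda_1-1)}=\sum_{(x,y)\in B_\lambda^\times}c^{(x,y)}_{B_\lambda}\,Q_{D_\mu\cup\{(x,y)\}},$$ where $c^{(x,y)}_{B_\lambda}=1$ if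 $(x,y)$ is the first box of $B_\lambda$ (that is, $(x-1,y),(x,y+1)\notin B_\lambda$) or the last box of $B_\lambda$ (that is, $(x+1,y),(x,y-1)\notin B_\lambda$), and $c^{(x,y)}_{B_\lambda}=2$ otherwise. (3) $Q_{\lambda/(1)}=\sum_{\nu\in E_\lambda}Q_\nu$, where $E_\lambda$ is the set of strict partitions $\nu$ whose shifted diagram is obtained from $D_\lambda$ by removing one corner. -/

import Mathlib

/-- A partition with distinct parts: a strictly decreasing finite list of positive integers. -/
@[ext]
structure StrictPartition where
  parts : List ℕ
  decreasing : parts.Pairwise (fun a b => b < a)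
  pos : ∀ p ∈ parts, 0 < p

namespace StrictPartition

/-- The number of parts. -/
def length (lam : StrictPartition) : ℕ := lam.parts.length

/-- The `i`-th part, with 1-based index `i`; it is `0` for `i` larger than the length. -/
def part (lam : StrictPartition) (i : ℕ) : ℕ := lam.parts.getD (i - 1) 0

/-- The empty partition. -/
def empty : StrictPartition where
  parts := []
  decreasing := List.Pairwise.nil
  pos := by simp

/-- The partition `(n)` with one part, for `n ≥ 1`. -/
def row (n : ℕ) (hn : 1 ≤ n) : StrictPartition where
  parts := [n]
  decreasing := List.pairwise_singleton _ _
  pos := by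
    intro p hp
    rw [List.mem_singleton.mp hp]
    exact hn

/-- The shifted diagram `{(i, j) | 1 ≤ i ≤ ℓ(λ), i ≤ j ≤ i + λ_i - 1}`; the box `(i, j)` lies in
row `i` and column `j`, rows being numbered from top to bottom. -/
def diagram (lam : StrictPartition) : Finset (ℕ × ℕ) :=
  (Finset.Icc 1 lam.length).biUnion fun i => {i} ×ˢ Finset.Icc i (i + lam.part i - 1)

/-- The border: the boxes `(x, y)` of the diagram with `(x + 1, y + 1)` not in the diagram. -/
def border (lam : StrictPartition) : Finset (ℕ × ℕ) :=
  lam.diagram.filter fun b => (b.1 + 1, b.2 + 1) ∉ lam.diagram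

end StrictPartition

/-- The graph on boxes in which two boxes are adjacent when they share an edge. -/
def boxGraph : SimpleGraph (ℕ × ℕ) where
  Adj a b := (a.1 = b.1 ∧ (a.2 + 1 = b.2 ∨ b.2 + 1 = a.2)) ∨
    (a.2 = b.2 ∧ (a.1 + 1 = b.1 ∨ b.1 + 1 = a.1))
  symm := ⟨fun a b h => by
    rcases h with ⟨h, h'⟩ | ⟨h, h'⟩
    · exact Or.inl ⟨h.symm, h'.symm⟩
    · exact Or.inr ⟨h.symm, h'.symm⟩⟩
  loopless := ⟨fun a h => by rcases h with ⟨_, h | h⟩ | ⟨_, h | h⟩ <;> omega⟩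

/-- The number of (edgewise connected) components of a finite set of boxes. -/
noncomputable def comp (D : Finset (ℕ × ℕ)) : ℕ :=
  Nat.card (boxGraph.induce (D : Set (ℕ × ℕ))).ConnectedComponent

/-- A corner of `D`: a box `(x, y) ∈ D` with `(x + 1, y), (x, y + 1) ∉ D`. -/
def IsCornerBox (D : Finset (ℕ × ℕ)) (b : ℕ × ℕ) : Prop :=
  b ∈ D ∧ (b.1 + 1, b.2) ∉ D ∧ (b.1, b.2 + 1) ∉ D

/-- The first (upper right) box of a border strip: `(x - 1, y), (x, y + 1) ∉ D`.
All boxes of diagrams have coordinates at least `1`, so the subtraction is harmless. -/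
def IsFirstBox (D : Finset (ℕ × ℕ)) (b : ℕ × ℕ) : Prop :=
  b ∈ D ∧ (b.1 - 1, b.2) ∉ D ∧ (b.1, b.2 + 1) ∉ D

/-- The last (lower left) box of a border strip: `(x + 1, y), (x, y - 1) ∉ D`. -/
def IsLastBox (D : Finset (ℕ × ℕ)) (b : ℕ × ℕ) : Prop :=
  b ∈ D ∧ (b.1 + 1, b.2) ∉ D ∧ (b.1, b.2 - 1) ∉ D

/-- The alphabet `1' < 1 < 2' < 2 < ⋯`, ordered lexicographically: `(k, false)` is the marked
letter `(k+1)'` and `(k, true)` is the unmarked letter `k+1`. -/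
abbrev Letter : Type := ℕ ×ₗ Bool

/-- The index of a letter (forgetting the mark): `k` for the letters `(k+1)'` and `k+1`. -/
def Letter.index (a : Letter) : ℕ := (ofLex a).1

/-- Whether a letter is unmarked. -/
def Letter.IsUnmarked (a : Letter) : Prop := (ofLex a).2 = true

/-- Tableaux on a finite set `D` of boxes. -/
structure ShiftedTableau (D : Finset (ℕ × ℕ)) where
  entry : D → Letter
  /-- entries weakly increase down each column -/
  le_down : ∀ a b : D, b.1 = (a.1.1 + 1, a.1.2) → entry a ≤ entry b
  /-- entries weakly increase along each row -/
  le_right : ∀ a b : D, b.1 = (a.1.1, a.1.2 + 1) → entry a ≤ entry b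
  /-- each column contains each unmarked letter at most once -/
  column : ∀ a b : D, a.1.2 = b.1.2 → entry a = entry b → (entry a).IsUnmarked → a = b
  /-- each row contains each marked letter at most once -/
  row : ∀ a b : D, a.1.1 = b.1.1 → entry a = entry b → ¬ (entry a).IsUnmarked → a = b

/-- The content: for each index the number of entries (marked or not) with this index. -/
noncomputable def ShiftedTableau.content {D : Finset (ℕ × ℕ)} (T : ShiftedTableau D) : ℕ →₀ ℕ :=
  ∑ b : D, Finsupp.single (T.entry b).index 1

/-- The generating function `Q_D = ∑_T x^{c(T)}` of the tableaux of shape `D`, in the countably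
many variables `x_1, x_2, …` (the variable with index `k : ℕ` is `x_{k+1}`): the coefficient of
`x^e` is the (finite) number of tableaux with content `e`. -/
noncomputable def diagramQ (D : Finset (ℕ × ℕ)) : MvPowerSeries ℕ ℤ :=
  fun e => (Nat.card {T : ShiftedTableau D // T.content = e} : ℤ)

namespace StrictPartition

/-- The skew Schur `Q`-function `Q_{λ/μ}`. -/
noncomputable def skewQ (lam mu : StrictPartition) : MvPowerSeries ℕ ℤ :=
  if mu.diagram ⊆ lam.diagram then diagramQ (lam.diagram \ mu.diagram) else 0

/-- The Schur `Q`-function `Q_λ = Q_{λ/∅}`. -/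
noncomputable def schurQ (lam : StrictPartition) : MvPowerSeries ℕ ℤ := skewQ lam empty

/-- The strict partitions `ν` with `D_ν ⊆ D_λ` such that `D_{λ/ν}` is contained in the border of
`λ` and has exactly `n` boxes. -/
def borderRemovals (lam : StrictPartition) (n : ℕ) : Set StrictPartition :=
  {nu | nu.diagram ⊆ lam.diagram ∧ lam.diagram \ nu.diagram ⊆ lam.border ∧
    (lam.diagram \ nu.diagram).card = n}

/-- The strict partitions whose diagram is obtained by removing a corner from `D_λ`. -/
def cornerRemovals (lam : StrictPartition) : Set StrictPartition :=
  {nu | ∃ b, IsCornerBox lam.diagram b ∧ nu.diagram = lam.diagram.erase b}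

/-- The boxes `(x, y)` of the border such that neither `(x - 1, y)` nor `(x, y - 1)` belongs to
the border. -/
def borderTimes (lam : StrictPartition) : Finset (ℕ × ℕ) :=
  lam.border.filter fun b => (b.1 - 1, b.2) ∉ lam.border ∧ (b.1, b.2 - 1) ∉ lam.border

open Classical in
/-- The coefficient of a box: `1` if it is the first or last box of the border, and `2`
otherwise. -/
noncomputable def borderCoeff (lam : StrictPartition) (b : ℕ × ℕ) : ℤ :=
  if IsFirstBox lam.border b ∨ IsLastBox lam.border b then 1 else 2

theorem schurQ_eq (lam : StrictPartition) : lam.schurQ = diagramQ lam.diagram := by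
  have h : empty.diagram = ∅ := rfl
  simp [schurQ, skewQ, h]

/-! Well-definedness: the index sets of the sums, and the sets of tableaux counted by the
coefficients, are finite. -/

theorem part_pos (lam : StrictPartition) {i : ℕ} (h1 : 1 ≤ i) (h2 : i ≤ lam.length) :
    0 < lam.part i := by
  have h : i - 1 < lam.parts.length := by unfold length at h2; omega
  unfold part
  rw [List.getD_eq_getElem _ _ h]
  exact lam.pos _ (List.getElem_mem h)

theorem part_eq_zero (lam : StrictPartition) {i : ℕ} (h : lam.length < i) : lam.part i = 0 := by
  unfold part
  apply List.getD_eq_default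
  unfold length at h
  omega

theorem mem_diagram (lam : StrictPartition) (x y : ℕ) :
    (x, y) ∈ lam.diagram ↔ 1 ≤ x ∧ x ≤ y ∧ y < x + lam.part x := by
  simp only [diagram, Finset.mem_biUnion, Finset.mem_Icc, Finset.mem_product,
    Finset.mem_singleton]
  constructor
  · rintro ⟨i, ⟨h1, h2⟩, rfl, h3, h4⟩
    have := lam.part_pos h1 h2
    omega
  · rintro ⟨h1, h2, h3⟩
    refine ⟨x, ⟨h1, ?_⟩, rfl, h2, by omega⟩
    by_contra h
    have := lam.part_eq_zero (not_le.mp h)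
    omega

theorem diagram_injective : Function.Injective diagram := by
  intro lam mu h
  have key : ∀ i, 1 ≤ i → lam.part i = mu.part i := by
    intro i hi
    have h1 : ∀ y, (i, y) ∈ lam.diagram ↔ (i, y) ∈ mu.diagram := fun y => by rw [h]
    simp only [mem_diagram] at h1
    have h2 := h1 (i + lam.part i)
    have h3 := h1 (i + mu.part i)
    omega
  have hlen : lam.length = mu.length := by
    rcases lt_trichotomy lam.length mu.length with hl | hl | hl
    · have h1 := mu.part_pos (i := mu.length) (by omega) le_rfl
      have h2 := lam.part_eq_zero hl
      have := key mu.length (by omega)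
      omega
    · exact hl
    · have h1 := lam.part_pos (i := lam.length) (by omega) le_rfl
      have h2 := mu.part_eq_zero hl
      have := key lam.length (by omega)
      omega
  ext1
  refine List.ext_getElem hlen fun i h1 h2 => ?_
  have := key (i + 1) (by omega)
  simpa [part, h1, h2] using this

theorem finite_subdiagrams (lam : StrictPartition) :
    {nu : StrictPartition | nu.diagram ⊆ lam.diagram}.Finite := by
  refine Set.Finite.of_finite_image (f := diagram) ?_ diagram_injective.injOn
  refine (Finset.finite_toSet lam.diagram.powerset).subset ?_
  rintro _ ⟨nu, hnu, rfl⟩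
  simpa using hnu

theorem borderRemovals_finite (lam : StrictPartition) (n : ℕ) :
    (lam.borderRemovals n).Finite :=
  lam.finite_subdiagrams.subset fun _ h => h.1

theorem cornerRemovals_finite (lam : StrictPartition) : lam.cornerRemovals.Finite :=
  lam.finite_subdiagrams.subset fun nu h => by
    obtain ⟨b, _, hb⟩ := h
    show nu.diagram ⊆ lam.diagram
    rw [hb]
    exact Finset.erase_subset _ _

end StrictPartition

theorem ShiftedTableau.finite_content_eq (D : Finset (ℕ × ℕ)) (e : ℕ →₀ ℕ) :
    Finite {T : ShiftedTableau D // T.content = e} := by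
  have hmem : ∀ T : {T : ShiftedTableau D // T.content = e}, ∀ b : D,
      (T.1.entry b).index ∈ e.support := by
    intro T b
    rw [Finsupp.mem_support_iff]
    intro h
    have h0 : T.1.content (T.1.entry b).index = 0 := by rw [T.2]; exact h
    rw [ShiftedTableau.content, Finsupp.finsetSum_apply] at h0
    have := (Finset.sum_eq_zero_iff.mp h0) b (Finset.mem_univ b)
    simp at this
  let f : {T : ShiftedTableau D // T.content = e} → (D → e.support × Bool) :=
    fun T b => (⟨(T.1.entry b).index, hmem T b⟩, (ofLex (T.1.entry b)).2)
  refine Finite.of_injective f ?_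
  rintro ⟨⟨t, _, _, _, _⟩, hT⟩ ⟨⟨s, _, _, _, _⟩, hS⟩ h
  have hts : t = s := by
    funext b
    have hb := congrFun h b
    simp only [f, Prod.mk.injEq, Subtype.mk.injEq, Letter.index] at hb
    exact ofLex.injective (Prod.ext hb.1 hb.2)
  subst hts
  rfl

/-!
The formulas for `Q_{λ/(n)}` follow from the commutation of two families of operators on strict
partitions. Let `U_n` have the matrix entry `2 ^ comp (λ/ν)` at `(λ, ν)` if `λ/ν` consists of `n`
boxes of the border of `λ`, and `0` otherwise (`ribbonMatrix`).

A tableau of shape `λ/ν` with all entries of one index exists only if no box has both a left and a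
lower neighbour, that is, if `λ/ν` lies in the border. A box with a left neighbour is then
unmarked, a box with a lower neighbour is marked, and the remaining box of each component is
free, so `U_n` counts these tableaux (`tabCount_single_of_isStrip`). Cutting a tableau at its
largest index (`tabCount_add_single`) shows that the matrix of the coefficients of `x ^ e` in the
skew `Q`-functions is the product of the operators `U_{e k}`.

The operators `U_m` and `U_n` commute (`ribbonMatrix_comm`). A strict partition is determined by
the lengths of its diagonals, and in these terms the generating function of the `U_n` is a product
of local weights along the diagonals, the transfer matrix of a free-fermionic six-vertex model.
The product of two such transfer matrices is computed one diagonal at a time, and the relations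
between the partial sums for the two orders of the factors are preserved at each step
(`Exchange.step`); this is the Yang-Baxter argument written out in coordinates.

Hence `U_n` commutes with the matrix of `Q`-coefficients. At the entry `(λ, ∅)` one order of the
product has the single term `2 Q_{λ/(n)}`, because only the row `(n)` is reached from `∅` by
`U_n`, and the other order is `∑ 2 ^ comp (λ/ν) Q_ν`. The formulas for `n = λ_1 - 1` and `n = 1`
are special cases: the border has one box on each of the `λ_1` diagonals, and the index set and the
numbers of components can be read off (`two_pow_comp_eq_borderCoeff`, `cornerRemovals_eq`).
-/

/-! ### Shifted diagrams and their diagonals -/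

/-- A downward closed proper subset of `ℕ` is an initial segment. -/
theorem exists_forall_iff_lt (p : ℕ → Prop) (h : ∀ m, p (m + 1) → p m) (hf : ∃ m, ¬ p m) :
    ∃ c, ∀ m, p m ↔ m < c := by
  classical
  refine ⟨Nat.find hf, fun m => ⟨fun hm => ?_, fun hm => not_not.mp (Nat.find_min hf hm)⟩⟩
  by_contra hlt
  have hdown : ∀ k, p (Nat.find hf + k) → p (Nat.find hf) := by
    intro k
    induction k with
    | zero => exact id
    | succ k ih => exact fun hk => ih (h _ hk)
  obtain ⟨k, rfl⟩ := Nat.exists_eq_add_of_le (not_lt.mp hlt)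
  exact Nat.find_spec hf (hdown k hm)

namespace StrictPartition

theorem part_succ_lt (lam : StrictPartition) {x : ℕ} (hx : 1 ≤ x) (h : 0 < lam.part (x + 1)) :
    lam.part (x + 1) < lam.part x := by
  have hl : x + 1 ≤ lam.length := by
    by_contra hl
    have := lam.part_eq_zero (not_le.mp hl)
    omega
  unfold length at hl
  have h1 : x - 1 < lam.parts.length := by omega
  have h2 : x < lam.parts.length := by omega
  have := List.pairwise_iff_getElem.mp lam.decreasing (x - 1) x h1 h2 (by omega)
  unfold part
  rw [List.getD_eq_getElem _ _ h1, Nat.add_sub_cancel, List.getD_eq_getElem _ _ h2]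
  exact this

theorem pos_of_mem {lam : StrictPartition} {x y : ℕ} (h : (x, y) ∈ lam.diagram) : 1 ≤ x ∧ x ≤ y :=
  ⟨((lam.mem_diagram x y).mp h).1, ((lam.mem_diagram x y).mp h).2.1⟩

theorem mem_up {lam : StrictPartition} {x y : ℕ} (h : (x + 1, y) ∈ lam.diagram) (hx : 1 ≤ x) :
    (x, y) ∈ lam.diagram := by
  rw [mem_diagram] at h ⊢
  have := lam.part_succ_lt hx (by omega)
  omega

theorem mem_left {lam : StrictPartition} {x y : ℕ} (h : (x, y + 1) ∈ lam.diagram) (hx : x ≤ y) :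
    (x, y) ∈ lam.diagram := by
  rw [mem_diagram] at h ⊢
  omega

theorem mem_diag {lam : StrictPartition} {x y : ℕ} (h : (x + 1, y + 1) ∈ lam.diagram)
    (hx : 1 ≤ x) : (x, y) ∈ lam.diagram :=
  mem_left (mem_up h hx) (by have := pos_of_mem h; omega)

/-- The diagram is closed under moving to the left and up. -/
theorem mem_of_le {lam : StrictPartition} {x y x' y' : ℕ} (h : (x, y) ∈ lam.diagram)
    (h1 : 1 ≤ x') (hx : x' ≤ x) (hxy : x' ≤ y') (hy : y' ≤ y) : (x', y') ∈ lam.diagram := by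
  obtain ⟨k, rfl⟩ := Nat.exists_eq_add_of_le hx
  obtain ⟨l, rfl⟩ := Nat.exists_eq_add_of_le hy
  have hup : (x', y' + l) ∈ lam.diagram := by
    clear hx
    induction k with
    | zero => exact h
    | succ k ih => exact ih (mem_up h (by omega))
  clear h hy
  induction l with
  | zero => exact hup
  | succ l ih => exact ih (mem_left hup (by omega))

/-- A finite set of boxes on and above the main diagonal that is closed under single steps to the
left and up is a shifted diagram. -/
theorem exists_diagram_eq (D : Finset (ℕ × ℕ)) (hpos : ∀ x y, (x, y) ∈ D → 1 ≤ x ∧ x ≤ y)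
    (hup : ∀ x y, (x + 1, y) ∈ D → 1 ≤ x → (x, y) ∈ D)
    (hleft : ∀ x y, (x, y + 1) ∈ D → x ≤ y → (x, y) ∈ D) :
    ∃ nu : StrictPartition, nu.diagram = D := by
  have hrow : ∀ x, ∃ r, ∀ m, (x, x + m) ∈ D ↔ m < r := by
    intro x
    refine exists_forall_iff_lt _ (fun m hm => hleft _ _ hm (by omega)) ?_
    by_contra! hall
    exact Set.infinite_of_injective_forall_mem (f := fun m => (x, x + m))
      (fun a b hab => by simpa using hab) hall D.finite_toSet
  choose r hr using hrow
  obtain ⟨l, hl⟩ := exists_forall_iff_lt (fun m => (m + 1, m + 1) ∈ D)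
    (fun m hm => hleft _ _ (hup _ _ hm (by omega)) le_rfl) (by
      by_contra! hall
      exact Set.infinite_of_injective_forall_mem (f := fun m => (m + 1, m + 1))
        (fun a b hab => by simpa using hab) hall D.finite_toSet)
  have hmul : ∀ k x y, (x + k, y) ∈ D → 1 ≤ x → (x, y) ∈ D := by
    intro k
    induction k with
    | zero => exact fun x y h _ => h
    | succ k ih => exact fun x y h hx => ih x y (hup _ _ h (by omega)) hx
  have hdec : ∀ i j, i < j → j < l → r (j + 1) < r (i + 1) := by
    intro i j hij hj
    by_contra! hle
    have h1 : (i + 1, i + 1 + 0) ∈ D := (hl i).mpr (by omega)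
    rw [hr] at h1
    have h2 : (j + 1, j + 1 + (r (i + 1) - 1)) ∈ D := by rw [hr]; omega
    obtain ⟨k, rfl⟩ := Nat.exists_eq_add_of_lt hij
    have h3 := hmul (k + 1) (i + 1) _ (by convert h2 using 2; omega) (by omega)
    have h4 : (i + 1, i + 1 + (r (i + 1) + k)) ∈ D := by convert h3 using 2; omega
    rw [hr] at h4
    omega
  have hpw : ((List.range l).map fun i => r (i + 1)).Pairwise fun a b => b < a := by
    rw [List.pairwise_iff_getElem]
    intro i j hi hj hij
    simp only [List.length_map, List.length_range] at hi hj
    simpa using hdec i j hij hj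
  have hps : ∀ p ∈ (List.range l).map fun i => r (i + 1), 0 < p := by
    intro p hp
    obtain ⟨i, hi, rfl⟩ := List.mem_map.mp hp
    have h1 : (i + 1, i + 1 + 0) ∈ D := (hl i).mpr (List.mem_range.mp hi)
    rwa [hr] at h1
  refine ⟨⟨_, hpw, hps⟩, ?_⟩
  ext ⟨x, y⟩
  rw [mem_diagram]
  by_cases hx : 1 ≤ x ∧ x ≤ l
  · have hp : part ⟨_, hpw, hps⟩ x
        = r x := by
      have h : x - 1 < ((List.range l).map fun i => r (i + 1)).length := by simp; omega
      simp only [part]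
      rw [List.getD_eq_getElem _ _ h]
      simp [Nat.sub_add_cancel hx.1]
    rw [hp]
    constructor
    · rintro ⟨-, h2, h3⟩
      have := (hr x (y - x)).mpr (by omega)
      rwa [Nat.add_sub_cancel' h2] at this
    · intro h
      have h2 := hpos _ _ h
      have := (hr x (y - x)).mp (by rwa [Nat.add_sub_cancel' h2.2])
      omega
  · constructor
    · rintro ⟨h1, h2, h3⟩
      rw [part_eq_zero _ (by simp only [length, List.length_map, List.length_range]; omega)]
        at h3
      omega
    · intro h
      exfalso
      have h2 := hpos _ _ h
      obtain ⟨m, rfl⟩ := Nat.exists_eq_add_of_le h2.1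
      have h3 : ∀ k, (1 + m, 1 + m + k) ∈ D → (1 + m, 1 + m) ∈ D := by
        intro k
        induction k with
        | zero => exact id
        | succ k ih => exact fun hk => ih (hleft _ _ hk (by omega))
      have h4 := h3 (y - (1 + m)) (by rwa [Nat.add_sub_cancel' h2.2])
      rw [Nat.add_comm] at h4
      have := (hl m).mp h4
      omega

/-- The number of boxes on the diagonal `y - x = k`. A strict partition is encoded below by
these numbers. -/
def diagLen (lam : StrictPartition) (k : ℕ) : ℕ :=
  (lam.diagram.filter fun b => b.2 = b.1 + k).card

theorem mem_iff_le_diagLen (lam : StrictPartition) (x k : ℕ) :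
    (x, x + k) ∈ lam.diagram ↔ 1 ≤ x ∧ x ≤ lam.diagLen k := by
  obtain ⟨c, hc⟩ := exists_forall_iff_lt (fun m => (m + 1, m + 1 + k) ∈ lam.diagram)
    (fun m hm => mem_diag (y := m + 1 + k) (by convert hm using 2; omega) (by omega)) (by
      by_contra! hall
      exact Set.infinite_of_injective_forall_mem (f := fun m => (m + 1, m + 1 + k))
        (fun a b hab => by simpa using hab) hall lam.diagram.finite_toSet)
  have hcard : lam.diagLen k = c := by
    have : (lam.diagram.filter fun b => b.2 = b.1 + k)
        = (Finset.range c).image fun m => (m + 1, m + 1 + k) := by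
      ext ⟨a, b⟩
      simp only [Finset.mem_filter, Finset.mem_image, Finset.mem_range, Prod.mk.injEq]
      constructor
      · rintro ⟨h, rfl⟩
        have h1 := (pos_of_mem h).1
        exact ⟨a - 1, (hc _).mp (by rwa [Nat.sub_add_cancel h1]), by omega, by omega⟩
      · rintro ⟨m, hm, rfl, rfl⟩
        exact ⟨(hc m).mpr hm, rfl⟩
    rw [diagLen, this, Finset.card_image_of_injective, Finset.card_range]
    intro a b hab
    simpa using hab
  rw [hcard]
  constructor
  · intro h
    have h1 := (pos_of_mem h).1
    have := (hc (x - 1)).mp (by rwa [Nat.sub_add_cancel h1])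
    omega
  · rintro ⟨h1, h2⟩
    have := (hc (x - 1)).mpr (by omega)
    rwa [Nat.sub_add_cancel h1] at this

theorem mem_iff_le_diagLen' (lam : StrictPartition) (x y : ℕ) :
    (x, y) ∈ lam.diagram ↔ 1 ≤ x ∧ x ≤ y ∧ x ≤ lam.diagLen (y - x) := by
  constructor
  · intro h
    have h1 := pos_of_mem h
    have := (lam.mem_iff_le_diagLen x (y - x)).mp (by rwa [Nat.add_sub_cancel' h1.2])
    exact ⟨h1.1, h1.2, this.2⟩
  · rintro ⟨h1, h2, h3⟩
    have := (lam.mem_iff_le_diagLen x (y - x)).mpr ⟨h1, h3⟩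
    rwa [Nat.add_sub_cancel' h2] at this

theorem diagLen_succ_le (lam : StrictPartition) (k : ℕ) :
    lam.diagLen (k + 1) ≤ lam.diagLen k := by
  by_contra! h
  have h1 := (lam.mem_iff_le_diagLen (lam.diagLen (k + 1)) (k + 1)).mpr ⟨by omega, le_rfl⟩
  have h2 := (lam.mem_iff_le_diagLen (lam.diagLen (k + 1)) k).mp (mem_left h1 (by omega))
  omega

theorem diagLen_le_succ (lam : StrictPartition) (k : ℕ) :
    lam.diagLen k ≤ lam.diagLen (k + 1) + 1 := by
  by_contra! h
  obtain ⟨m, hm⟩ : ∃ m, lam.diagLen k = m + 1 := ⟨lam.diagLen k - 1, by omega⟩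
  have h1 := (lam.mem_iff_le_diagLen (m + 1) k).mpr ⟨by omega, hm.ge⟩
  have h2 : (m, m + (k + 1)) ∈ lam.diagram := by
    convert mem_up h1 (by omega) using 2
    omega
  have := (lam.mem_iff_le_diagLen _ _).mp h2
  omega

theorem diagLen_injective : Function.Injective diagLen := by
  intro lam mu h
  apply diagram_injective
  ext ⟨x, y⟩
  rw [mem_iff_le_diagLen', mem_iff_le_diagLen', h]

theorem subset_iff_diagLen_le (lam mu : StrictPartition) :
    mu.diagram ⊆ lam.diagram ↔ ∀ k, mu.diagLen k ≤ lam.diagLen k := by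
  constructor
  · exact fun h k => Finset.card_le_card (Finset.filter_subset_filter _ h)
  · rintro h ⟨x, y⟩ hb
    rw [mem_iff_le_diagLen'] at hb ⊢
    exact ⟨hb.1, hb.2.1, hb.2.2.trans (h _)⟩

theorem diagLen_eq_zero (lam : StrictPartition) {k : ℕ} (h : lam.part 1 ≤ k) :
    lam.diagLen k = 0 := by
  by_contra hk
  have := (lam.mem_iff_le_diagLen 1 k).mpr ⟨le_rfl, by omega⟩
  rw [mem_diagram] at this
  omega

theorem diagLen_pos (lam : StrictPartition) {k : ℕ} (h : k < lam.part 1) :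
    0 < lam.diagLen k :=
  ((lam.mem_iff_le_diagLen 1 k).mp ((lam.mem_diagram _ _).mpr (by omega))).2

/-- Every eventually zero sequence whose successive drops are `0` or `1` is the sequence of
diagonal lengths of a strict partition. -/
theorem exists_diagLen_eq (d : ℕ → ℕ) (N : ℕ) (hN : ∀ k, N ≤ k → d k = 0)
    (h1 : ∀ k, d (k + 1) ≤ d k) (h2 : ∀ k, d k ≤ d (k + 1) + 1) :
    ∃ nu : StrictPartition, nu.diagLen = d := by
  have hle : ∀ k, d k ≤ d 0 := by
    intro k
    induction k with
    | zero => rfl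
    | succ k ih => exact (h1 k).trans ih
  let D : Finset (ℕ × ℕ) := (Finset.range (d 0 + 1) ×ˢ Finset.range (d 0 + N)).filter
    fun b => 1 ≤ b.1 ∧ b.1 ≤ b.2 ∧ b.1 ≤ d (b.2 - b.1)
  have hD : ∀ x y, (x, y) ∈ D ↔ 1 ≤ x ∧ x ≤ y ∧ x ≤ d (y - x) := by
    intro x y
    simp only [D, Finset.mem_filter, Finset.mem_product, Finset.mem_range, and_iff_right_iff_imp]
    rintro ⟨hx, hxy, hd⟩
    have := hle (y - x)
    have : y - x < N := by
      by_contra hc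
      have := hN (y - x) (by omega)
      omega
    omega
  obtain ⟨nu, hnu⟩ := exists_diagram_eq D (fun x y h => by rw [hD] at h; omega)
    (fun x y h hx => by
      rw [hD] at h ⊢
      have := h2 (y - (x + 1))
      rw [show y - (x + 1) + 1 = y - x by omega] at *
      have := h1 (y - (x + 1))
      rw [show y - (x + 1) + 1 = y - x by omega] at *
      omega)
    (fun x y h hx => by
      rw [hD] at h ⊢
      have := h1 (y - x)
      rw [show y - x + 1 = y + 1 - x by omega] at this
      omega)
  refine ⟨nu, funext fun k => ?_⟩
  have key : ∀ x, 1 ≤ x → (x ≤ nu.diagLen k ↔ x ≤ d k) := by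
    intro x hx
    have h3 := nu.mem_iff_le_diagLen x k
    rw [hnu, hD, Nat.add_sub_cancel_left] at h3
    have : x ≤ x + k := Nat.le_add_right _ _
    tauto
  have h3 := key (nu.diagLen k)
  have h4 := key (d k)
  omega

end StrictPartition

/-! ### Strips: components and tableaux with a single index -/

open Classical in
/-- The boxes of `D` with neither a left nor a lower neighbour in `D`. In a border strip each
component contains exactly one of them. -/
noncomputable def lastBoxes (D : Finset (ℕ × ℕ)) : Finset (ℕ × ℕ) := D.filter (IsLastBox D)

theorem mem_lastBoxes {D : Finset (ℕ × ℕ)} {b : ℕ × ℕ} : b ∈ lastBoxes D ↔ IsLastBox D b := by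
  simp only [lastBoxes, Finset.mem_filter, and_iff_right_iff_imp]
  exact fun h => h.1

/-- A set of boxes on and above the main diagonal in which no box has both a left and a lower
neighbour. -/
structure IsStrip (D : Finset (ℕ × ℕ)) : Prop where
  pos : ∀ x y, (x, y) ∈ D → 1 ≤ x ∧ x ≤ y
  not_both : ∀ x y, (x, y) ∈ D → (x, y + 1) ∈ D → (x + 1, y + 1) ∉ D

/-- One step to the left or down inside `D`, if there is one; the identity otherwise. -/
def stripStep (D : Finset (ℕ × ℕ)) (b : ℕ × ℕ) : ℕ × ℕ :=
  if (b.1, b.2 - 1) ∈ D then (b.1, b.2 - 1) else if (b.1 + 1, b.2) ∈ D then (b.1 + 1, b.2) else b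

/-- The box reached by walking left and down until this is no longer possible. Each step lowers
the number of the diagonal by one, so `b.2 - b.1` steps suffice. -/
def stripRoot (D : Finset (ℕ × ℕ)) (b : ℕ × ℕ) : ℕ × ℕ := (stripStep D)^[b.2 - b.1] b

section Strip

variable {D : Finset (ℕ × ℕ)}

theorem stripStep_of_isLastBox {b : ℕ × ℕ} (h : IsLastBox D b) : stripStep D b = b := by
  simp [stripStep, h.2.1, h.2.2]

theorem stripRoot_of_isLastBox {b : ℕ × ℕ} (h : IsLastBox D b) : stripRoot D b = b :=
  Function.iterate_fixed (stripStep_of_isLastBox h) _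

theorem stripStep_spec (hD : IsStrip D) {b : ℕ × ℕ} (hb : b ∈ D) (h : ¬ IsLastBox D b) :
    stripStep D b ∈ D ∧ boxGraph.Adj b (stripStep D b) ∧
      (stripStep D b).2 - (stripStep D b).1 + 1 = b.2 - b.1 := by
  obtain ⟨x, y⟩ := b
  have hp := hD.pos _ _ hb
  unfold stripStep
  split_ifs with h1 h2
  · have := hD.pos _ _ h1
    exact ⟨h1, Or.inl ⟨rfl, Or.inr (by dsimp only; omega)⟩, by dsimp only at *; omega⟩
  · have := hD.pos _ _ h2
    exact ⟨h2, Or.inr ⟨rfl, Or.inl rfl⟩, by dsimp only at *; omega⟩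
  · exact absurd ⟨hb, h2, h1⟩ h

theorem stripRoot_step (hD : IsStrip D) {b : ℕ × ℕ} (hb : b ∈ D) :
    stripRoot D (stripStep D b) = stripRoot D b := by
  by_cases h : IsLastBox D b
  · rw [stripStep_of_isLastBox h]
  · rw [stripRoot, stripRoot, ← (stripStep_spec hD hb h).2.2, Function.iterate_succ_apply]

theorem stripRoot_spec (hD : IsStrip D) {b : ℕ × ℕ} (hb : b ∈ D) :
    ∃ h : stripRoot D b ∈ D, IsLastBox D (stripRoot D b) ∧
      (boxGraph.induce (D : Set (ℕ × ℕ))).Reachable ⟨b, hb⟩ ⟨stripRoot D b, h⟩ := by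
  induction hk : b.2 - b.1 generalizing b with
  | zero =>
    have hp := hD.pos _ _ hb
    have hl : IsLastBox D b := by
      refine ⟨hb, fun h => ?_, fun h => ?_⟩
      · have := hD.pos _ _ h
        omega
      · have := hD.pos _ _ h
        omega
    refine ⟨?_, ?_, ?_⟩
    · rwa [stripRoot_of_isLastBox hl]
    · rwa [stripRoot_of_isLastBox hl]
    · simp only [stripRoot_of_isLastBox hl]
      exact SimpleGraph.Reachable.refl _
  | succ k ih =>
    by_cases hl : IsLastBox D b
    · refine ⟨?_, ?_, ?_⟩
      · rwa [stripRoot_of_isLastBox hl]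
      · rwa [stripRoot_of_isLastBox hl]
      · simp only [stripRoot_of_isLastBox hl]
        exact SimpleGraph.Reachable.refl _
    · obtain ⟨h1, h2, h3⟩ := stripStep_spec hD hb hl
      obtain ⟨h4, h5, h6⟩ := ih h1 (by omega)
      simp only [stripRoot_step hD hb] at h4 h5 h6
      exact ⟨h4, h5, (SimpleGraph.Adj.reachable (by simpa using h2)).trans h6⟩

/-- Of two adjacent boxes of a strip one is the step of the other, because no box has both a left
and a lower neighbour. -/
theorem stripRoot_eq_of_adj (hD : IsStrip D) {a b : ℕ × ℕ} (ha : a ∈ D) (hb : b ∈ D)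
    (h : boxGraph.Adj a b) : stripRoot D a = stripRoot D b := by
  have hleft : ∀ x y, (x, y) ∈ D → (x, y + 1) ∈ D →
      stripRoot D (x, y) = stripRoot D (x, y + 1) := by
    intro x y h1 h2
    rw [← stripRoot_step hD h2]
    simp [stripStep, h1]
  have hdown : ∀ x y, (x, y) ∈ D → (x + 1, y) ∈ D →
      stripRoot D (x, y) = stripRoot D (x + 1, y) := by
    intro x y h1 h2
    have hp := hD.pos _ _ h1
    have h3 : (x, y - 1) ∉ D := fun h3 => by
      obtain ⟨z, rfl⟩ : ∃ z, y = z + 1 := ⟨y - 1, by omega⟩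
      exact hD.not_both x z h3 h1 h2
    rw [← stripRoot_step hD h1]
    simp [stripStep, h3, h2]
  obtain ⟨x, y⟩ := a
  obtain ⟨x', y'⟩ := b
  rcases h with ⟨h1, h2 | h2⟩ | ⟨h1, h2 | h2⟩ <;> dsimp only at h1 h2 <;> subst h1 <;> subst h2
  · exact hleft _ _ ha hb
  · exact (hleft _ _ hb ha).symm
  · exact hdown _ _ ha hb
  · exact (hdown _ _ hb ha).symm

/-- Every box of a strip is connected to its root, which is a last box, and the root is constant on
components. -/
theorem comp_eq_card_lastBoxes (hD : IsStrip D) : comp D = (lastBoxes D).card := by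
  rw [comp, ← Nat.card_eq_finsetCard]
  symm
  refine Nat.card_congr (Equiv.ofBijective (fun b : lastBoxes D =>
    (boxGraph.induce (D : Set (ℕ × ℕ))).connectedComponentMk
      ⟨b.1, (mem_lastBoxes.mp b.2).1⟩) ⟨?_, ?_⟩)
  · intro a b hab
    obtain ⟨p⟩ := SimpleGraph.ConnectedComponent.exact hab
    have hwalk : ∀ {u v : (D : Set (ℕ × ℕ))},
        (boxGraph.induce (D : Set (ℕ × ℕ))).Walk u v → stripRoot D u = stripRoot D v := by
      intro u v p
      induction p with
      | nil => rfl
      | cons hadj _ ih => exact (stripRoot_eq_of_adj hD (Subtype.prop _) (Subtype.prop _)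
          (by simpa using hadj)).trans ih
    have := hwalk p
    rw [stripRoot_of_isLastBox (mem_lastBoxes.mp a.2),
      stripRoot_of_isLastBox (mem_lastBoxes.mp b.2)] at this
    exact Subtype.ext this
  · intro c
    induction c using SimpleGraph.ConnectedComponent.ind with
    | _ v =>
      obtain ⟨h1, h2, h3⟩ := stripRoot_spec hD v.2
      exact ⟨⟨_, mem_lastBoxes.mpr h2⟩, SimpleGraph.ConnectedComponent.sound h3.symm⟩

end Strip

/-- The number of tableaux of shape `D` and content `e`. -/
noncomputable def tabCount (D : Finset (ℕ × ℕ)) (e : ℕ →₀ ℕ) : ℕ :=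
  Nat.card {T : ShiftedTableau D // T.content = e}

namespace ShiftedTableau

variable {D : Finset (ℕ × ℕ)}

theorem entry_injective : Function.Injective (entry : ShiftedTableau D → D → Letter) := by
  rintro ⟨t, _, _, _, _⟩ ⟨s, _, _, _, _⟩ h
  subst h
  rfl

theorem content_apply (T : ShiftedTableau D) (k : ℕ) :
    T.content k = (Finset.univ.filter fun b : D => (T.entry b).index = k).card := by
  rw [content, Finsupp.finsetSum_apply, Finset.card_filter]
  simp [Finsupp.single_apply]

theorem index_mem_support (T : ShiftedTableau D) (b : D) :
    (T.entry b).index ∈ T.content.support := by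
  rw [Finsupp.mem_support_iff, content_apply, Finset.card_ne_zero]
  exact ⟨b, by simp⟩

theorem content_eq_single_iff (T : ShiftedTableau D) (K n : ℕ) :
    T.content = Finsupp.single K n ↔ (∀ b, (T.entry b).index = K) ∧ D.card = n := by
  have hK : (∀ b, (T.entry b).index = K) → T.content = Finsupp.single K D.card := by
    intro h
    simp [content, h]
  constructor
  · intro h
    have h1 : ∀ b, (T.entry b).index = K := by
      intro b
      have := T.index_mem_support b
      rw [h] at this
      simpa using Finsupp.support_single_subset this
    refine ⟨h1, ?_⟩
    rw [hK h1] at h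
    exact Finsupp.single_injective K h
  · rintro ⟨h1, rfl⟩
    exact hK h1

end ShiftedTableau

/-- Order-convexity of a set of boxes along rows and columns. -/
structure IsLineConvex (D : Finset (ℕ × ℕ)) : Prop where
  row : ∀ x y z w, (x, y) ∈ D → (x, w) ∈ D → y ≤ z → z ≤ w → (x, z) ∈ D
  col : ∀ x y z w, (x, y) ∈ D → (w, y) ∈ D → x ≤ z → z ≤ w → (z, y) ∈ D

theorem Letter.ext_iff' {a b : Letter} :
    a = b ↔ a.index = b.index ∧ (a.IsUnmarked ↔ b.IsUnmarked) := by
  unfold Letter.index Letter.IsUnmarked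
  rw [← ofLex.injective.eq_iff, Prod.ext_iff, Bool.coe_iff_coe]

theorem Letter.le_iff {a b : Letter} :
    a ≤ b ↔ a.index < b.index ∨ a.index = b.index ∧ (a.IsUnmarked → b.IsUnmarked) := by
  unfold Letter.index Letter.IsUnmarked
  rw [Prod.Lex.le_iff, Bool.le_iff_imp]

/-- In a tableau with a single index, a box with a left neighbour is unmarked and a box with a
lower neighbour is marked. -/
theorem ShiftedTableau.unmarked_of_left {D : Finset (ℕ × ℕ)} (T : ShiftedTableau D) {K : ℕ}
    (hT : ∀ b, (T.entry b).index = K) (a b : D) (hab : b.1 = (a.1.1, a.1.2 + 1)) :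
    (T.entry b).IsUnmarked := by
  by_contra h
  have h1 := T.le_right a b hab
  rw [Letter.le_iff, hT, hT] at h1
  have h2 : ¬ (T.entry a).IsUnmarked := fun h2 => h ((h1.resolve_left (lt_irrefl _)).2 h2)
  have h3 := T.row a b (by rw [hab]) (Letter.ext_iff'.mpr ⟨by rw [hT, hT], by tauto⟩) h2
  rw [← h3] at hab
  simpa using congrArg Prod.snd hab

theorem ShiftedTableau.marked_of_down {D : Finset (ℕ × ℕ)} (T : ShiftedTableau D) {K : ℕ}
    (hT : ∀ b, (T.entry b).index = K) (a b : D) (hab : b.1 = (a.1.1 + 1, a.1.2)) :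
    ¬ (T.entry a).IsUnmarked := by
  intro h
  have h1 := T.le_down a b hab
  rw [Letter.le_iff, hT, hT] at h1
  have h2 : (T.entry b).IsUnmarked := (h1.resolve_left (lt_irrefl _)).2 h
  have h3 := T.column a b (by rw [hab]) (Letter.ext_iff'.mpr ⟨by rw [hT, hT], by tauto⟩) h
  rw [← h3] at hab
  simpa using congrArg Prod.fst hab

open Classical in
/-- The filling of a strip with letters of index `K` whose marks on the last boxes are given;
every other box has a left neighbour and is unmarked, or has a lower neighbour and is marked. -/
noncomputable def stripTableau {D : Finset (ℕ × ℕ)} (hD : IsStrip D) (hc : IsLineConvex D) (K : ℕ)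
    (m : lastBoxes D → Bool) : ShiftedTableau D where
  entry b := toLex (K, if h : b.1 ∈ lastBoxes D then m ⟨b.1, h⟩ else
    decide ((b.1.1, b.1.2 - 1) ∈ D))
  le_down := by
    rintro ⟨⟨x, y⟩, ha⟩ ⟨b, hb⟩ h
    dsimp only at h
    subst h
    have hp := hD.pos _ _ ha
    have h1 : (x, y - 1) ∉ D := fun h1 => by
      obtain ⟨z, rfl⟩ : ∃ z, y = z + 1 := ⟨y - 1, by omega⟩
      exact hD.not_both x z h1 ha hb
    have h2 : (x, y) ∉ lastBoxes D := fun h => (mem_lastBoxes.mp h).2.1 hb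
    rw [Letter.le_iff]
    right
    simp [Letter.index, Letter.IsUnmarked, h1, h2]
  le_right := by
    rintro ⟨⟨x, y⟩, ha⟩ ⟨b, hb⟩ h
    dsimp only at h
    subst h
    have h2 : (x, y + 1) ∉ lastBoxes D := fun h => (mem_lastBoxes.mp h).2.2 ha
    rw [Letter.le_iff]
    right
    simp [Letter.index, Letter.IsUnmarked, h2, ha]
  column := by
    have key : ∀ x y w (ha : (x, y) ∈ D) (hb : (w, y) ∈ D), x < w →
        ¬ Letter.IsUnmarked (toLex (K, if h : (x, y) ∈ lastBoxes D then m ⟨(x, y), h⟩ else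
          decide ((x, y - 1) ∈ D))) := by
      intro x y w ha hb hlt
      have hd := hc.col x y (x + 1) w ha hb (by omega) (by omega)
      have hp := hD.pos _ _ ha
      have h1 : (x, y - 1) ∉ D := fun h1 => by
        obtain ⟨z, rfl⟩ : ∃ z, y = z + 1 := ⟨y - 1, by omega⟩
        exact hD.not_both x z h1 ha hd
      have h2 : (x, y) ∉ lastBoxes D := fun h => (mem_lastBoxes.mp h).2.1 hd
      simp [Letter.IsUnmarked, h1, h2]
    rintro ⟨⟨x, y⟩, ha⟩ ⟨⟨w, y'⟩, hb⟩ h he hu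
    dsimp only at h
    subst h
    rcases lt_trichotomy x w with hlt | rfl | hlt
    · exact absurd hu (key _ _ _ ha hb hlt)
    · rfl
    · rw [he] at hu
      exact absurd hu (key _ _ _ hb ha hlt)
  row := by
    have key : ∀ x y w (ha : (x, y) ∈ D) (hb : (x, w) ∈ D), y < w →
        Letter.IsUnmarked (toLex (K, if h : (x, w) ∈ lastBoxes D then m ⟨(x, w), h⟩ else
          decide ((x, w - 1) ∈ D))) := by
      intro x y w ha hb hlt
      have h1 := hc.row x y (w - 1) w ha hb (by omega) (by omega)
      have h2 : (x, w) ∉ lastBoxes D := fun h => (mem_lastBoxes.mp h).2.2 h1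
      simp [Letter.IsUnmarked, h1, h2]
    rintro ⟨⟨x, y⟩, ha⟩ ⟨⟨x', w⟩, hb⟩ h he hu
    dsimp only at h
    subst h
    rcases lt_trichotomy y w with hlt | rfl | hlt
    · rw [he] at hu
      exact absurd (key _ _ _ ha hb hlt) hu
    · rfl
    · exact absurd (key _ _ _ hb ha hlt) hu

theorem tabCount_single_of_isStrip {D : Finset (ℕ × ℕ)} (hD : IsStrip D) (hc : IsLineConvex D)
    (K : ℕ) : tabCount D (Finsupp.single K D.card) = 2 ^ comp D := by
  classical
  have hcard : 2 ^ comp D = Nat.card (lastBoxes D → Bool) := by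
    rw [comp_eq_card_lastBoxes hD]
    simp
  rw [hcard, tabCount]
  refine Nat.card_congr (Equiv.ofBijective (fun T b => (ofLex (T.1.entry
    ⟨b.1, (mem_lastBoxes.mp b.2).1⟩)).2) ⟨?_, ?_⟩)
  · rintro ⟨T, hT⟩ ⟨S, hS⟩ h
    rw [ShiftedTableau.content_eq_single_iff] at hT hS
    refine Subtype.ext (ShiftedTableau.entry_injective (funext fun b => ?_))
    rw [Letter.ext_iff', hT.1, hS.1]
    refine ⟨rfl, ?_⟩
    by_cases hb : b.1 ∈ lastBoxes D
    · have := congrFun h ⟨b.1, hb⟩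
      unfold Letter.IsUnmarked
      dsimp only at this ⊢
      rw [this]
    · obtain ⟨⟨x, y⟩, hb'⟩ := b
      have hp := hD.pos _ _ hb'
      by_cases h1 : (x, y - 1) ∈ D
      · have h2 : (x, y) = (x, y - 1 + 1) := by rw [Nat.sub_add_cancel (by omega)]
        exact iff_of_true (T.unmarked_of_left hT.1 ⟨_, h1⟩ _ h2)
          (S.unmarked_of_left hS.1 ⟨_, h1⟩ _ h2)
      · by_cases h2 : (x + 1, y) ∈ D
        · exact iff_of_false (T.marked_of_down hT.1 _ ⟨_, h2⟩ rfl)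
            (S.marked_of_down hS.1 _ ⟨_, h2⟩ rfl)
        · exact absurd (mem_lastBoxes.mpr ⟨hb', h2, h1⟩) hb
  · intro m
    refine ⟨⟨stripTableau hD hc K m, ?_⟩, ?_⟩
    · rw [ShiftedTableau.content_eq_single_iff]
      exact ⟨fun _ => rfl, rfl⟩
    · funext b
      simp [stripTableau, b.2]

theorem tabCount_single_eq_zero {D : Finset (ℕ × ℕ)} {x y : ℕ} (h1 : (x, y) ∈ D)
    (h2 : (x, y + 1) ∈ D) (h3 : (x + 1, y + 1) ∈ D) (K n : ℕ) :
    tabCount D (Finsupp.single K n) = 0 := by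
  rw [tabCount, Nat.card_eq_zero]
  left
  rw [isEmpty_subtype]
  intro T hT
  rw [ShiftedTableau.content_eq_single_iff] at hT
  exact T.marked_of_down hT.1 ⟨_, h2⟩ ⟨_, h3⟩ rfl (T.unmarked_of_left hT.1 ⟨_, h1⟩ ⟨_, h2⟩ rfl)

theorem tabCount_single_of_card_ne {D : Finset (ℕ × ℕ)} {K n : ℕ} (h : D.card ≠ n) :
    tabCount D (Finsupp.single K n) = 0 := by
  rw [tabCount, Nat.card_eq_zero]
  left
  rw [isEmpty_subtype]
  intro T hT
  exact h ((ShiftedTableau.content_eq_single_iff T K n).mp hT).2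

/-! ### Commutation of the strip operators -/

/-- The sequence with head `f 0 + b` and tail `f`. -/
def consSeq (b : ℤ) (f : ℕ → ℤ) : ℕ → ℤ
  | 0 => f 0 + b
  | k + 1 => f k

/-- The tail of a sequence. -/
def tailSeq (f : ℕ → ℤ) : ℕ → ℤ := fun k => f (k + 1)

theorem consSeq_injective {b c : ℤ} {f g : ℕ → ℤ} (h : consSeq b f = consSeq c g) :
    b = c ∧ f = g := by
  have hfg : f = g := funext fun k => congrFun h (k + 1)
  subst hfg
  have := congrFun h 0
  simp only [consSeq] at this
  exact ⟨by omega, rfl⟩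

open Classical in
/-- The integer sequences that vanish from position `N` on and whose successive drops are `0` or
`1`: the sequences of diagonal lengths of the strict partitions with parts at most `N`. -/
noncomputable def paths : ℕ → Finset (ℕ → ℤ)
  | 0 => {fun _ => 0}
  | N + 1 => (({0, 1} : Finset ℤ) ×ˢ paths N).image fun p => consSeq p.1 p.2

theorem mem_paths (N : ℕ) (f : ℕ → ℤ) : f ∈ paths N ↔
    (∀ k, N ≤ k → f k = 0) ∧ ∀ k, f k = f (k + 1) ∨ f k = f (k + 1) + 1 := by
  induction N generalizing f with
  | zero =>
    simp only [paths, Finset.mem_singleton, zero_le, forall_const]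
    constructor
    · rintro rfl
      simp
    · exact fun h => funext h.1
  | succ N ih =>
    simp only [paths, Finset.mem_image, Finset.mem_product, Prod.exists, ih, Finset.mem_insert,
      Finset.mem_singleton]
    constructor
    · rintro ⟨b, g, ⟨hb, h1, h2⟩, rfl⟩
      refine ⟨fun k hk => ?_, fun k => ?_⟩
      · obtain ⟨j, rfl⟩ : ∃ j, k = j + 1 := ⟨k - 1, by omega⟩
        exact h1 j (by omega)
      · cases k with
        | zero => simp only [consSeq]; omega
        | succ k => exact h2 k
    · rintro ⟨h1, h2⟩
      refine ⟨f 0 - f 1, tailSeq f, ⟨?_, fun k hk => h1 _ (by omega), fun k => h2 _⟩, ?_⟩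
      · have := h2 0
        simp only [zero_add] at this
        omega
      · funext k
        cases k with
        | zero => simp [consSeq, tailSeq]
        | succ k => rfl

theorem sum_paths_succ {R : Type*} [AddCommMonoid R] (N : ℕ) (F : (ℕ → ℤ) → R) :
    ∑ u ∈ paths (N + 1), F u = ∑ u ∈ paths N, (F (consSeq 0 u) + F (consSeq 1 u)) := by
  classical
  rw [paths, Finset.sum_image, Finset.sum_product_right]
  · simp
  · rintro ⟨b, f⟩ - ⟨c, g⟩ - h
    obtain ⟨h1, h2⟩ := consSeq_injective h
    exact Prod.ext h1 h2

section Transfer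

variable {R : Type*} [CommRing R]

/-- The local weight of a strip on one diagonal: `h` and `h'` are the numbers of its boxes on
this diagonal and on the next one. A box has weight `x`, and a factor `2` stands for a component
that begins on the next diagonal. -/
def localWeight (x : R) (h h' : ℤ) : R :=
  if h = 0 then (if h' = 1 then 2 else 1) else if h = 1 then x else 0

/-- The weight of the strip between the diagrams with diagonal lengths `g` and `f`, except for
the factor `2` of a component beginning on the main diagonal. -/
def stripWeight (x : R) (N : ℕ) (f g : ℕ → ℤ) : R :=
  ∏ k ∈ Finset.range N, localWeight x (f k - g k) (f (k + 1) - g (k + 1))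

theorem stripWeight_succ (x : R) (N : ℕ) (f g : ℕ → ℤ) : stripWeight x (N + 1) f g =
    localWeight x (f 0 - g 0) (f 1 - g 1) * stripWeight x N (tailSeq f) (tailSeq g) := by
  rw [stripWeight, Finset.prod_range_succ', mul_comm]
  rfl

/-- The two-strip sum over the middle paths `u` with `f 0 - u 0 = h`. -/
noncomputable def pathSum (x y : R) (N : ℕ) (f g : ℕ → ℤ) (h : ℤ) : R :=
  ∑ u ∈ paths N, if f 0 - u 0 = h then stripWeight x N f u * stripWeight y N u g else 0

/-- Prepending one diagonal. Here `s` and `t` are the drops of `f` and `g`, `d` is the difference of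
their tails, and the two summands are the two possible drops of the middle path. -/
theorem pathSum_succ (x y : R) (N : ℕ) (f g : ℕ → ℤ) (h s t d : ℤ) (hs : f 0 = f 1 + s)
    (ht : g 0 = g 1 + t) (hd : f 1 - g 1 = d) : pathSum x y (N + 1) f g h =
      localWeight x h (h - s) * localWeight y (d + s - t - h) (d - (h - s)) *
        pathSum x y N (tailSeq f) (tailSeq g) (h - s) +
      localWeight x h (h - s + 1) * localWeight y (d + s - t - h) (d - (h - s + 1)) *
        pathSum x y N (tailSeq f) (tailSeq g) (h - s + 1) := by
  have key : ∀ (b : ℤ) (u : ℕ → ℤ),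
      (if f 0 - consSeq b u 0 = h then
        stripWeight x (N + 1) f (consSeq b u) * stripWeight y (N + 1) (consSeq b u) g else 0) =
      localWeight x h (h - s + b) * localWeight y (d + s - t - h) (d - (h - s + b)) *
        if tailSeq f 0 - u 0 = h - s + b then
          stripWeight x N (tailSeq f) u * stripWeight y N u (tailSeq g) else 0 := by
    intro b u
    have hb : consSeq b u 0 = u 0 + b := rfl
    have hu : consSeq b u 1 = u 0 := rfl
    have hf : tailSeq f 0 = f 1 := rfl
    have htail : tailSeq (consSeq b u) = u := rfl
    by_cases hc : f 1 - u 0 = h - s + b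
    · rw [if_pos (by omega), if_pos (by omega), stripWeight_succ, stripWeight_succ, htail, hu, hb,
        show f 0 - (u 0 + b) = h by omega, hc, show u 0 + b - g 0 = d + s - t - h by omega,
        show u 0 - g 1 = d - (h - s + b) by omega]
      ring
    · rw [if_neg (by omega), if_neg (by omega), mul_zero]
  simp only [pathSum, sum_paths_succ, Finset.mul_sum, Finset.sum_add_distrib, key, add_zero]

/-- The relations between the two-strip sums `G` and `G'` with the two weights interchanged, where
`d` is the difference of the outer and the inner diagonal length. For `d = 1` the two middle
positions are related by a matrix that depends on the weights, as in the Yang-Baxter equation. -/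
structure Exchange (x y : R) (d : ℤ) (G G' : ℤ → R) : Prop where
  zero_left : ∀ h, (h ≠ 0 ∧ h ≠ 1 ∨ d - h ≠ 0 ∧ d - h ≠ 1) → G h = 0
  zero_right : ∀ h, (h ≠ 0 ∧ h ≠ 1 ∨ d - h ≠ 0 ∧ d - h ≠ 1) → G' h = 0
  eq_zero : d = 0 → G 0 = G' 0
  eq_one : d = 1 → G 0 + G 1 = G' 0 + G' 1
  exchange : d = 1 → (x + y) * (G 1 - G' 1) = (x - y) * (G 0 + G 1)
  eq_two : d = 2 → G 1 = G' 1

theorem localWeight_of_ne {x : R} {h : ℤ} (h' : ℤ) (h0 : h ≠ 0) (h1 : h ≠ 1) :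
    localWeight x h h' = 0 := by
  simp [localWeight, h0, h1]

/-- The relations survive prepending a diagonal on which the outer sequences drop by `s` and `t`.
Outside `d ∈ {0, 1, 2}` all sums vanish; otherwise at most two terms are nonzero, and the claim is
a polynomial identity in each of the cases. -/
theorem Exchange.step {x y : R} {d s t : ℤ} {G G' H H' : ℤ → R} (hG : Exchange x y d G G')
    (hs : s = 0 ∨ s = 1) (ht : t = 0 ∨ t = 1)
    (hH : ∀ h, H h = localWeight x h (h - s) * localWeight y (d + s - t - h) (d - (h - s)) *
        G (h - s) + localWeight x h (h - s + 1) *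
        localWeight y (d + s - t - h) (d - (h - s + 1)) * G (h - s + 1))
    (hH' : ∀ h, H' h = localWeight y h (h - s) * localWeight x (d + s - t - h) (d - (h - s)) *
        G' (h - s) + localWeight y h (h - s + 1) *
        localWeight x (d + s - t - h) (d - (h - s + 1)) * G' (h - s + 1)) :
    Exchange x y (d + s - t) H H' := by
  by_cases hd : d = 0 ∨ d = 1 ∨ d = 2
  · have e0 := hG.eq_zero
    have e1 := hG.eq_one
    have e2 := hG.exchange
    have e3 := hG.eq_two
    have z1 := hG.zero_left
    have z2 := hG.zero_right
    refine ⟨fun h hh => ?_, fun h hh => ?_, fun hd' => ?_, fun hd' => ?_, fun hd' => ?_,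
      fun hd' => ?_⟩
    · rw [hH]
      rcases hh with hh | hh <;> simp [localWeight_of_ne _ hh.1 hh.2]
    · rw [hH']
      rcases hh with hh | hh <;> simp [localWeight_of_ne _ hh.1 hh.2]
    all_goals
      have z1m := z1 (-1)
      have z1a := z1 0
      have z1b := z1 1
      have z1c := z1 2
      have z2m := z2 (-1)
      have z2a := z2 0
      have z2b := z2 1
      have z2c := z2 2
      simp only [hH, hH']
      clear z1 z2 hH hH' hG
      rcases hs with rfl | rfl <;> rcases ht with rfl | rfl <;>
      rcases hd with rfl | rfl | rfl <;> norm_num [localWeight] at * <;>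
      grind
  · have z1 : ∀ h, G h = 0 := fun h => hG.zero_left h (by omega)
    have z2 : ∀ h, G' h = 0 := fun h => hG.zero_right h (by omega)
    have z3 : ∀ h, H h = 0 := fun h => by simp [hH, z1]
    have z4 : ∀ h, H' h = 0 := fun h => by simp [hH', z2]
    constructor <;> simp [z3, z4]

theorem exchange_pathSum (x y : R) (N : ℕ) (f g : ℕ → ℤ) (hf : f ∈ paths N) (hg : g ∈ paths N) :
    Exchange x y (f 0 - g 0) (pathSum x y N f g) (pathSum y x N f g) := by
  induction N generalizing f g with
  | zero =>
    simp only [paths, Finset.mem_singleton] at hf hg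
    subst hf hg
    have hG : ∀ (z w : R) (h : ℤ),
        pathSum z w 0 (fun _ => 0) (fun _ => 0) h = if h = 0 then 1 else 0 := fun z w h => by
      simp only [pathSum, paths, Finset.sum_singleton, stripWeight, Finset.range_zero,
        Finset.prod_empty, mul_one, sub_zero, eq_comm]
    have hz : ∀ (z w : R) (h : ℤ),
        (h ≠ 0 ∧ h ≠ 1 ∨ (0 : ℤ) - 0 - h ≠ 0 ∧ (0 : ℤ) - 0 - h ≠ 1) →
        pathSum z w 0 (fun _ => 0) (fun _ => 0) h = 0 := fun z w h hh => by
      rw [hG, if_neg (by omega)]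
    constructor
    · exact hz x y
    · exact hz y x
    all_goals simp [hG]
  | succ N ih =>
    rw [mem_paths] at hf hg
    have hf' : tailSeq f ∈ paths N :=
      (mem_paths _ _).mpr ⟨fun k hk => hf.1 _ (by omega), fun k => hf.2 _⟩
    have hg' : tailSeq g ∈ paths N :=
      (mem_paths _ _).mpr ⟨fun k hk => hg.1 _ (by omega), fun k => hg.2 _⟩
    have h1 := hf.2 0
    have h2 := hg.2 0
    simp only [zero_add] at h1 h2
    have hs : f 0 = f 1 + (f 0 - f 1) := by ring
    have ht : g 0 = g 1 + (g 0 - g 1) := by ring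
    have key := (ih _ _ hf' hg').step (s := f 0 - f 1) (t := g 0 - g 1) (by omega) (by omega)
      (fun h => pathSum_succ x y N f g h _ _ _ hs ht rfl)
      (fun h => pathSum_succ y x N f g h _ _ _ hs ht rfl)
    have hd : tailSeq f 0 - tailSeq g 0 + (f 0 - f 1) - (g 0 - g 1) = f 0 - g 0 := by
      simp only [tailSeq, zero_add]
      ring
    rwa [hd] at key

/-- The weight of the strip between the diagrams with diagonal lengths `g` and `f`: a factor `x`
for each box and a factor `2` for each component. -/
def fullWeight (x : R) (N : ℕ) (f g : ℕ → ℤ) : R :=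
  (if f 0 - g 0 = 1 then 2 else 1) * stripWeight x N f g

theorem stripWeight_eq_zero {x : R} {N k : ℕ} {f g : ℕ → ℤ} (hk : k < N) (h0 : f k - g k ≠ 0)
    (h1 : f k - g k ≠ 1) : stripWeight x N f g = 0 :=
  Finset.prod_eq_zero (Finset.mem_range.mpr hk) (localWeight_of_ne _ h0 h1)

/-- The full two-strip sum in terms of the partial sums: only `0` and `1` are possible numbers of
boxes of the outer strip on the main diagonal, and the factors `2` there are put back in. -/
theorem sum_fullWeight_eq (x y : R) (N : ℕ) (f g : ℕ → ℤ) (hf : f ∈ paths N) :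
    ∑ u ∈ paths N, fullWeight x N f u * fullWeight y N u g =
      (if f 0 - g 0 = 1 then 2 else 1) * pathSum x y N f g 0 +
        2 * (if f 0 - g 0 = 2 then 2 else 1) * pathSum x y N f g 1 := by
  simp only [pathSum, Finset.mul_sum, ← Finset.sum_add_distrib]
  refine Finset.sum_congr rfl fun u hu => ?_
  by_cases h0 : f 0 - u 0 = 0
  · have e : u 0 - g 0 = f 0 - g 0 := by omega
    simp only [fullWeight, h0, e]
    norm_num
    split_ifs <;> ring
  · by_cases h1 : f 0 - u 0 = 1
    · have e : u 0 - g 0 = 1 ↔ f 0 - g 0 = 2 := by omega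
      simp only [fullWeight, h1, e]
      norm_num
      split_ifs <;> ring
    · have hN : 0 < N := by
        by_contra hN
        rw [mem_paths] at hf hu
        rw [hf.1 0 (by omega), hu.1 0 (by omega)] at h0
        exact h0 rfl
      simp [fullWeight, stripWeight_eq_zero hN h0 h1, h0, h1]

theorem sum_fullWeight_comm (x y : R) (N : ℕ) (f g : ℕ → ℤ) (hf : f ∈ paths N)
    (hg : g ∈ paths N) :
    ∑ u ∈ paths N, fullWeight x N f u * fullWeight y N u g =
      ∑ u ∈ paths N, fullWeight y N f u * fullWeight x N u g := by
  rw [sum_fullWeight_eq x y N f g hf, sum_fullWeight_eq y x N f g hf]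
  have h := exchange_pathSum x y N f g hf hg
  generalize f 0 - g 0 = d at h
  have z1a := h.zero_left 0
  have z1b := h.zero_left 1
  have z2a := h.zero_right 0
  have z2b := h.zero_right 1
  by_cases h0 : d = 0
  · subst h0
    rw [h.eq_zero rfl, z1b (by omega), z2b (by omega)]
  · by_cases h1 : d = 1
    · subst h1
      have := h.eq_one rfl
      norm_num
      linear_combination 2 * this
    · by_cases h2 : d = 2
      · subst h2
        rw [h.eq_two rfl, z1a (by omega), z2a (by omega)]
      · rw [z1a (by omega), z1b (by omega), z2a (by omega), z2b (by omega)]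

end Transfer

/-! ### Skew diagrams inside the border -/

namespace StrictPartition

/-- `lam / nu` is a border strip, possibly disconnected: `nu ⊆ lam` and the removed boxes lie in
the border of `lam`. -/
def IsRibbon (lam nu : StrictPartition) : Prop :=
  nu.diagram ⊆ lam.diagram ∧ lam.diagram \ nu.diagram ⊆ lam.border

theorem mem_border {lam : StrictPartition} {x y : ℕ} :
    (x, y) ∈ lam.border ↔ (x, y) ∈ lam.diagram ∧ (x + 1, y + 1) ∉ lam.diagram := by
  simp [border]

theorem isRibbon_iff (lam nu : StrictPartition) : lam.IsRibbon nu ↔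
    ∀ k, nu.diagLen k ≤ lam.diagLen k ∧ lam.diagLen k ≤ nu.diagLen k + 1 := by
  rw [IsRibbon, subset_iff_diagLen_le, forall_and]
  refine and_congr_right fun hle => ⟨fun h k => ?_, ?_⟩
  · by_contra! hk
    have h1 : (nu.diagLen k + 1, nu.diagLen k + 1 + k) ∈ lam.diagram \ nu.diagram := by
      rw [Finset.mem_sdiff, mem_iff_le_diagLen, mem_iff_le_diagLen]
      omega
    refine (mem_border.mp (h h1)).2 ?_
    rw [show nu.diagLen k + 1 + k + 1 = nu.diagLen k + 1 + 1 + k by ring, mem_iff_le_diagLen]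
    omega
  · rintro h ⟨x, y⟩ hb
    obtain ⟨h1, h2⟩ := Finset.mem_sdiff.mp hb
    rw [mem_border]
    refine ⟨h1, fun h3 => ?_⟩
    rw [mem_iff_le_diagLen'] at h1 h2 h3
    rw [show y + 1 - (x + 1) = y - x by omega] at h3
    have := h (y - x)
    omega

theorem isLineConvex_sdiff (lam nu : StrictPartition) :
    IsLineConvex (lam.diagram \ nu.diagram) := by
  constructor
  · intro x y z w h1 h2 h3 h4
    rw [Finset.mem_sdiff] at *
    have hp := pos_of_mem h1.1
    exact ⟨mem_of_le h2.1 hp.1 le_rfl (by omega) h4,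
      fun h => h1.2 (mem_of_le h hp.1 le_rfl hp.2 h3)⟩
  · intro x y z w h1 h2 h3 h4
    rw [Finset.mem_sdiff] at *
    have hp := pos_of_mem h1.1
    have hp' := pos_of_mem h2.1
    exact ⟨mem_of_le h2.1 (by omega) h4 (by omega) le_rfl,
      fun h => h1.2 (mem_of_le h hp.1 h3 hp.2 le_rfl)⟩

theorem IsRibbon.isStrip {lam nu : StrictPartition} (h : lam.IsRibbon nu) :
    IsStrip (lam.diagram \ nu.diagram) where
  pos _ _ hb := pos_of_mem (Finset.mem_sdiff.mp hb).1
  not_both _ _ hb _ hc := (mem_border.mp (h.2 hb)).2 (Finset.mem_sdiff.mp hc).1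

/-- A box of `lam / nu` outside the border produces a box with both a left and a lower
neighbour. -/
theorem exists_square_of_not_isRibbon {lam nu : StrictPartition} (hs : nu.diagram ⊆ lam.diagram)
    (h : ¬ lam.IsRibbon nu) : ∃ x y, (x, y) ∈ lam.diagram \ nu.diagram ∧
      (x, y + 1) ∈ lam.diagram \ nu.diagram ∧ (x + 1, y + 1) ∈ lam.diagram \ nu.diagram := by
  obtain ⟨⟨x, y⟩, hb, hn⟩ := Finset.not_subset.mp fun hc => h ⟨hs, hc⟩
  obtain ⟨h1, h2⟩ := Finset.mem_sdiff.mp hb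
  rw [mem_border, not_and, not_not] at hn
  have h3 := hn h1
  have hp := pos_of_mem h1
  refine ⟨x, y, hb, Finset.mem_sdiff.mpr ⟨mem_up h3 hp.1, fun hc => h2 (mem_left hc hp.2)⟩,
    Finset.mem_sdiff.mpr ⟨h3, fun hc => h2 (mem_diag hc hp.1)⟩⟩

/-- The diagonals meeting `lam / nu`, among the first `N`. -/
def ribbonDiagonals (lam nu : StrictPartition) (N : ℕ) : Finset ℕ :=
  (Finset.range N).filter fun k => nu.diagLen k < lam.diagLen k

theorem mem_ribbonDiagonals {lam nu : StrictPartition} {N k : ℕ} (hN : lam.diagLen N = 0) :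
    k ∈ lam.ribbonDiagonals nu N ↔ nu.diagLen k < lam.diagLen k := by
  simp only [ribbonDiagonals, Finset.mem_filter, Finset.mem_range, and_iff_right_iff_imp]
  intro h
  by_contra hk
  have : ∀ j, lam.diagLen (N + j) = 0 := by
    intro j
    induction j with
    | zero => exact hN
    | succ j ih => exact Nat.le_zero.mp ((lam.diagLen_succ_le (N + j)).trans ih.le)
  have := this (k - N)
  rw [Nat.add_sub_cancel' (not_lt.mp hk)] at this
  omega

/-- A ribbon has exactly one box on each diagonal that it meets. -/
theorem IsRibbon.mem_iff {lam nu : StrictPartition} (h : lam.IsRibbon nu) (x y : ℕ) :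
    (x, y) ∈ lam.diagram \ nu.diagram ↔
      x ≤ y ∧ x = lam.diagLen (y - x) ∧ nu.diagLen (y - x) < lam.diagLen (y - x) := by
  have := (lam.isRibbon_iff nu).mp h (y - x)
  rw [Finset.mem_sdiff, mem_iff_le_diagLen', mem_iff_le_diagLen']
  omega

theorem IsRibbon.card_eq {lam nu : StrictPartition} (h : lam.IsRibbon nu) {N : ℕ}
    (hN : lam.diagLen N = 0) :
    (lam.diagram \ nu.diagram).card = (lam.ribbonDiagonals nu N).card := by
  symm
  refine Finset.card_bij (fun k _ => (lam.diagLen k, lam.diagLen k + k)) ?_ ?_ ?_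
  · intro k hk
    rw [mem_ribbonDiagonals hN] at hk
    rw [h.mem_iff, Nat.add_sub_cancel_left]
    exact ⟨Nat.le_add_right _ _, rfl, hk⟩
  · intro k _ l _ hkl
    rw [Prod.mk.injEq] at hkl
    omega
  · rintro ⟨x, y⟩ hb
    rw [h.mem_iff] at hb
    refine ⟨y - x, (mem_ribbonDiagonals hN).mpr hb.2.2, ?_⟩
    rw [← hb.2.1, Nat.add_sub_cancel' hb.1]

/-- The box on diagonal `k` starts a component iff diagonal `k - 1` is not met: two boxes on
neighbouring diagonals of the border are adjacent. -/
theorem IsRibbon.isLastBox_iff {lam nu : StrictPartition} (h : lam.IsRibbon nu) (k : ℕ)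
    (hk : nu.diagLen k < lam.diagLen k) :
    IsLastBox (lam.diagram \ nu.diagram) (lam.diagLen k, lam.diagLen k + k) ↔
      k = 0 ∨ nu.diagLen (k - 1) = lam.diagLen (k - 1) := by
  have hr := (lam.isRibbon_iff nu).mp h
  simp only [IsLastBox, h.mem_iff]
  cases k with
  | zero => simp [hk]; omega
  | succ k =>
    have h1 := lam.diagLen_succ_le k
    have h2 := lam.diagLen_le_succ k
    have h3 := hr k
    have e1 : lam.diagLen (k + 1) + (k + 1) - lam.diagLen (k + 1) = k + 1 := by omega
    have e2 : lam.diagLen (k + 1) + (k + 1) - (lam.diagLen (k + 1) + 1) = k := by omega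
    have e3 : lam.diagLen (k + 1) + (k + 1) - 1 - lam.diagLen (k + 1) = k := by omega
    simp only [e1, e2, e3, Nat.add_sub_cancel, true_and, Nat.succ_ne_zero, false_or]
    clear e1 e2 e3
    by_cases he : nu.diagLen k = lam.diagLen k
    · simp [he, hk]
    · simp only [he, iff_false]
      omega

theorem IsRibbon.comp_eq {lam nu : StrictPartition} (h : lam.IsRibbon nu) {N : ℕ}
    (hN : lam.diagLen N = 0) :
    comp (lam.diagram \ nu.diagram) = ((lam.ribbonDiagonals nu N).filter
      fun k => k = 0 ∨ nu.diagLen (k - 1) = lam.diagLen (k - 1)).card := by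
  rw [comp_eq_card_lastBoxes h.isStrip]
  symm
  refine Finset.card_bij (fun k _ => (lam.diagLen k, lam.diagLen k + k)) ?_ ?_ ?_
  · intro k hk
    rw [Finset.mem_filter, mem_ribbonDiagonals hN] at hk
    exact mem_lastBoxes.mpr ((h.isLastBox_iff k hk.1).mpr hk.2)
  · intro k _ l _ hkl
    rw [Prod.mk.injEq] at hkl
    omega
  · rintro ⟨x, y⟩ hb
    have hb' := mem_lastBoxes.mp hb
    have h1 := (h.mem_iff _ _).mp hb'.1
    have e : (x, y) = (lam.diagLen (y - x), lam.diagLen (y - x) + (y - x)) := by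
      rw [← h1.2.1, Nat.add_sub_cancel' h1.1]
    refine ⟨y - x, ?_, e.symm⟩
    rw [Finset.mem_filter, mem_ribbonDiagonals hN]
    rw [e] at hb'
    exact ⟨h1.2.2, (h.isLastBox_iff _ h1.2.2).mp hb'⟩

theorem IsRibbon.comp_pos {lam nu : StrictPartition} (h : lam.IsRibbon nu)
    (hne : (lam.diagram \ nu.diagram).Nonempty) : 0 < comp (lam.diagram \ nu.diagram) := by
  rw [comp_eq_card_lastBoxes h.isStrip, Finset.card_pos]
  obtain ⟨b, hb⟩ := hne
  obtain ⟨_, h2, _⟩ := stripRoot_spec h.isStrip hb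
  exact ⟨_, mem_lastBoxes.mpr h2⟩

/-- The diagonal lengths as an integer sequence. -/
def diagSeq (lam : StrictPartition) : ℕ → ℤ := fun k => lam.diagLen k

/-- The product of local weights counts boxes and components. Summed over the diagonals, the
factors `2` stand for the components beginning on diagonals `1, 2, …`; the initial factor accounts
for diagonal `0`. -/
theorem fullWeight_diagSeq {R : Type*} [CommRing R] (x : R) {N : ℕ} {lam nu : StrictPartition}
    (hlam : ∀ k, N ≤ k → lam.diagLen k = 0) (hnu : ∀ k, N ≤ k → nu.diagLen k = 0) :
    (open Classical in if lam.IsRibbon nu then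
      2 ^ comp (lam.diagram \ nu.diagram) * x ^ (lam.diagram \ nu.diagram).card else 0) =
      fullWeight x N lam.diagSeq nu.diagSeq := by
  classical
  by_cases h : lam.IsRibbon nu
  · have hN := hlam N le_rfl
    have hr := (lam.isRibbon_iff nu).mp h
    rw [if_pos h, h.comp_eq hN, h.card_eq hN, ribbonDiagonals, Finset.filter_filter,
      ← Finset.prod_const, ← Finset.prod_const, Finset.prod_filter, Finset.prod_filter,
      fullWeight, stripWeight]
    have hloc : ∀ k, localWeight x (lam.diagSeq k - nu.diagSeq k)
        (lam.diagSeq (k + 1) - nu.diagSeq (k + 1)) =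
        (if nu.diagLen (k + 1) < lam.diagLen (k + 1) ∧
          (k + 1 = 0 ∨ nu.diagLen (k + 1 - 1) = lam.diagLen (k + 1 - 1)) then 2 else 1) *
        if nu.diagLen k < lam.diagLen k then x else 1 := by
      intro k
      have h1 := hr k
      have h2 := hr (k + 1)
      have e0 : lam.diagSeq k - nu.diagSeq k = 0 ↔ nu.diagLen k = lam.diagLen k := by
        simp only [diagSeq]; omega
      have e1 : lam.diagSeq k - nu.diagSeq k = 1 ↔ nu.diagLen k < lam.diagLen k := by
        simp only [diagSeq]; omega
      have e2 : lam.diagSeq (k + 1) - nu.diagSeq (k + 1) = 1 ↔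
          nu.diagLen (k + 1) < lam.diagLen (k + 1) := by
        simp only [diagSeq]; omega
      simp only [localWeight, e0, e1, e2, Nat.add_sub_cancel, Nat.succ_ne_zero, false_or]
      by_cases h3 : nu.diagLen k = lam.diagLen k
      · simp [h3]
      · have h4 : nu.diagLen k < lam.diagLen k := by omega
        simp [h3, h4]
    rw [Finset.prod_congr rfl fun k _ => hloc k, Finset.prod_mul_distrib, ← mul_assoc]
    congr 1
    have e : (lam.diagSeq 0 - nu.diagSeq 0 = 1) ↔
        nu.diagLen 0 < lam.diagLen 0 ∧ (0 = 0 ∨ nu.diagLen (0 - 1) = lam.diagLen (0 - 1)) := by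
      have := hr 0
      simp only [diagSeq, true_or, and_true]
      omega
    rw [if_congr e rfl rfl, mul_comm, ← Finset.prod_range_succ' (fun k =>
      if nu.diagLen k < lam.diagLen k ∧ (k = 0 ∨ nu.diagLen (k - 1) = lam.diagLen (k - 1))
        then (2 : R) else 1),
      Finset.prod_range_succ, if_neg (by omega), mul_one]
  · rw [if_neg h]
    rw [isRibbon_iff] at h
    push Not at h
    obtain ⟨k, hk⟩ := h
    have hkN : k < N := by
      by_contra hkN
      have := hlam k (by omega)
      have := hnu k (by omega)
      omega
    rw [fullWeight, stripWeight_eq_zero hkN, mul_zero]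
    · simp only [diagSeq]
      omega
    · simp only [diagSeq]
      omega

theorem diagSeq_mem_paths {lam : StrictPartition} {N : ℕ}
    (h : ∀ k, N ≤ k → lam.diagLen k = 0) : lam.diagSeq ∈ paths N := by
  rw [mem_paths]
  refine ⟨fun k hk => by simp [diagSeq, h k hk], fun k => ?_⟩
  have h1 := lam.diagLen_succ_le k
  have h2 := lam.diagLen_le_succ k
  simp only [diagSeq]
  omega

theorem diagSeq_injective : Function.Injective diagSeq := by
  intro lam mu h
  refine diagLen_injective (funext fun k => ?_)
  have := congrFun h k
  simpa [diagSeq] using this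

theorem exists_diagSeq_eq {N : ℕ} {u : ℕ → ℤ} (hu : u ∈ paths N) :
    ∃ nu : StrictPartition, nu.diagSeq = u ∧ ∀ k, N ≤ k → nu.diagLen k = 0 := by
  rw [mem_paths] at hu
  have hnn : ∀ j k, N ≤ k + j → 0 ≤ u k := by
    intro j
    induction j with
    | zero => exact fun k hk => (hu.1 k hk).ge
    | succ j ih =>
      intro k hk
      have := ih (k + 1) (by omega)
      have := hu.2 k
      omega
  have hpos : ∀ k, 0 ≤ u k := fun k => hnn N k (by omega)
  obtain ⟨nu, hnu⟩ := exists_diagLen_eq (fun k => (u k).toNat) N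
    (fun k hk => by simp [hu.1 k hk])
    (fun k => by have := hu.2 k; have := hpos (k + 1); omega)
    (fun k => by have := hu.2 k; have := hpos (k + 1); omega)
  refine ⟨nu, funext fun k => ?_, fun k hk => ?_⟩
  · rw [diagSeq, hnu]
    exact Int.toNat_of_nonneg (hpos k)
  · rw [hnu]
    simp [hu.1 k hk]

end StrictPartition

/-! ### Splitting a tableau at its largest index -/

namespace ShiftedTableau

variable {D : Finset (ℕ × ℕ)}

/-- The restriction of a tableau to a subset of its boxes. -/
def restrict (T : ShiftedTableau D) {E : Finset (ℕ × ℕ)} (h : E ⊆ D) : ShiftedTableau E where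
  entry b := T.entry ⟨b.1, h b.2⟩
  le_down _ _ hab := T.le_down _ _ hab
  le_right _ _ hab := T.le_right _ _ hab
  column _ _ h1 h2 h3 := Subtype.ext (congrArg (fun c : D => c.1) (T.column _ _ h1 h2 h3))
  row _ _ h1 h2 h3 := Subtype.ext (congrArg (fun c : D => c.1) (T.row _ _ h1 h2 h3))

theorem content_eq_sum (T : ShiftedTableau D) (g : ℕ × ℕ → ℕ)
    (hg : ∀ b : D, g b.1 = (T.entry b).index) :
    T.content = ∑ b ∈ D, Finsupp.single (g b) 1 := by
  rw [content, ← Finset.sum_coe_sort D fun b => Finsupp.single (g b) 1]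
  exact Finset.sum_congr rfl fun b _ => by rw [hg]

theorem content_restrict_add {E F : Finset (ℕ × ℕ)} (T : ShiftedTableau D) (hE : E ⊆ D)
    (hF : F ⊆ D) (hdisj : Disjoint E F) (hunion : E ∪ F = D) :
    (T.restrict hE).content + (T.restrict hF).content = T.content := by
  classical
  let g : ℕ × ℕ → ℕ := fun b => if h : b ∈ D then (T.entry ⟨b, h⟩).index else 0
  rw [T.content_eq_sum g fun b => by simp [g],
    (T.restrict hE).content_eq_sum g fun b => by simp [g, hE b.2, restrict],
    (T.restrict hF).content_eq_sum g fun b => by simp [g, hF b.2, restrict],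
    ← Finset.sum_union hdisj, hunion]

end ShiftedTableau

namespace StrictPartition

section Glue

variable {lam nu mu : StrictPartition}

theorem sdiff_union_sdiff (h1 : mu.diagram ⊆ nu.diagram) (h2 : nu.diagram ⊆ lam.diagram) :
    (nu.diagram \ mu.diagram) ∪ (lam.diagram \ nu.diagram) = lam.diagram \ mu.diagram := by
  ext b
  have := @h1 b
  have := @h2 b
  simp only [Finset.mem_union, Finset.mem_sdiff]
  tauto

theorem disjoint_sdiffs :
    Disjoint (nu.diagram \ mu.diagram) (lam.diagram \ nu.diagram) :=
  Finset.disjoint_left.mpr fun _ ha hb =>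
    (Finset.mem_sdiff.mp hb).2 (Finset.mem_sdiff.mp ha).1

/-- The union of a tableau of shape `nu / mu` and a tableau of shape `lam / nu` whose entries are
larger. -/
def glueTableau (S : ShiftedTableau (nu.diagram \ mu.diagram))
    (T : ShiftedTableau (lam.diagram \ nu.diagram)) (hlt : ∀ a b, S.entry a < T.entry b) :
    ShiftedTableau (lam.diagram \ mu.diagram) where
  entry b := if h : b.1 ∈ nu.diagram then
      S.entry ⟨b.1, Finset.mem_sdiff.mpr ⟨h, (Finset.mem_sdiff.mp b.2).2⟩⟩
    else T.entry ⟨b.1, Finset.mem_sdiff.mpr ⟨(Finset.mem_sdiff.mp b.2).1, h⟩⟩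
  le_down := by
    rintro ⟨⟨x, y⟩, ha⟩ ⟨b, hb⟩ h
    dsimp only at h
    subst h
    have hp := pos_of_mem (Finset.mem_sdiff.mp ha).1
    by_cases h1 : (x + 1, y) ∈ nu.diagram
    · simp only [h1, mem_up h1 hp.1, dif_pos]
      exact S.le_down _ _ rfl
    · by_cases h2 : (x, y) ∈ nu.diagram
      · simp only [h1, h2, dif_pos, dif_neg, not_false_eq_true]
        exact (hlt _ _).le
      · simp only [h1, h2, dif_neg, not_false_eq_true]
        exact T.le_down _ _ rfl
  le_right := by
    rintro ⟨⟨x, y⟩, ha⟩ ⟨b, hb⟩ h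
    dsimp only at h
    subst h
    have hp := pos_of_mem (Finset.mem_sdiff.mp ha).1
    by_cases h1 : (x, y + 1) ∈ nu.diagram
    · simp only [h1, mem_left h1 hp.2, dif_pos]
      exact S.le_right _ _ rfl
    · by_cases h2 : (x, y) ∈ nu.diagram
      · simp only [h1, h2, dif_pos, dif_neg, not_false_eq_true]
        exact (hlt _ _).le
      · simp only [h1, h2, dif_neg, not_false_eq_true]
        exact T.le_right _ _ rfl
  column := by
    rintro a b h he hu
    by_cases h1 : a.1 ∈ nu.diagram <;> by_cases h2 : b.1 ∈ nu.diagram <;>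
      simp only [h1, h2, dif_pos, dif_neg, not_false_eq_true] at he hu
    · exact Subtype.ext (congrArg (fun c : ↥(nu.diagram \ mu.diagram) => c.1)
        (S.column _ _ h he hu))
    · exact absurd he (hlt _ _).ne
    · exact absurd he (hlt _ _).ne'
    · exact Subtype.ext (congrArg (fun c : ↥(lam.diagram \ nu.diagram) => c.1)
        (T.column _ _ h he hu))
  row := by
    rintro a b h he hu
    by_cases h1 : a.1 ∈ nu.diagram <;> by_cases h2 : b.1 ∈ nu.diagram <;>
      simp only [h1, h2, dif_pos, dif_neg, not_false_eq_true] at he hu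
    · exact Subtype.ext (congrArg (fun c : ↥(nu.diagram \ mu.diagram) => c.1)
        (S.row _ _ h he hu))
    · exact absurd he (hlt _ _).ne
    · exact absurd he (hlt _ _).ne'
    · exact Subtype.ext (congrArg (fun c : ↥(lam.diagram \ nu.diagram) => c.1)
        (T.row _ _ h he hu))

end Glue

theorem lt_of_content {D E : Finset (ℕ × ℕ)} {S : ShiftedTableau D} {T : ShiftedTableau E}
    {e : ℕ →₀ ℕ} {K n : ℕ} (he : ∀ k ∈ e.support, k < K) (hS : S.content = e)
    (hT : T.content = Finsupp.single K n) (a : D) (b : E) : S.entry a < T.entry b := by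
  have h1 := he _ (hS ▸ S.index_mem_support a)
  have h2 := ((T.content_eq_single_iff K n).mp hT).1 b
  rw [← not_le, Letter.le_iff]
  omega

/-- The boxes of `mu` together with those of small index form a shifted diagram. -/
theorem exists_diagram_of_index_lt {lam mu : StrictPartition} (hs : mu.diagram ⊆ lam.diagram)
    (T : ShiftedTableau (lam.diagram \ mu.diagram)) (K : ℕ) :
    ∃ nu : StrictPartition, mu.diagram ⊆ nu.diagram ∧ nu.diagram ⊆ lam.diagram ∧
      ∀ b : ↥(lam.diagram \ mu.diagram), b.1 ∈ nu.diagram ↔ (T.entry b).index < K := by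
  classical
  let I : Finset (ℕ × ℕ) := lam.diagram.filter fun b => b ∈ mu.diagram ∨
    ∃ h : b ∈ lam.diagram \ mu.diagram, (T.entry ⟨b, h⟩).index < K
  have hidx : ∀ a b, T.entry a ≤ T.entry b → (T.entry b).index < K → (T.entry a).index < K := by
    intro a b hab hb
    rw [Letter.le_iff] at hab
    omega
  obtain ⟨nu, hnu⟩ := exists_diagram_eq I
    (fun x y h => pos_of_mem (Finset.mem_filter.mp h).1)
    (fun x y h hx => by
      obtain ⟨h1, h2⟩ := Finset.mem_filter.mp h
      refine Finset.mem_filter.mpr ⟨mem_up h1 hx, ?_⟩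
      by_cases hm : (x, y) ∈ mu.diagram
      · exact Or.inl hm
      · obtain ⟨h3, h4⟩ := h2.resolve_left fun hc => hm (mem_up hc hx)
        exact Or.inr ⟨Finset.mem_sdiff.mpr ⟨mem_up h1 hx, hm⟩, hidx _ _ (T.le_down _ _ rfl) h4⟩)
    (fun x y h hx => by
      obtain ⟨h1, h2⟩ := Finset.mem_filter.mp h
      refine Finset.mem_filter.mpr ⟨mem_left h1 hx, ?_⟩
      by_cases hm : (x, y) ∈ mu.diagram
      · exact Or.inl hm
      · obtain ⟨h3, h4⟩ := h2.resolve_left fun hc => hm (mem_left hc hx)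
        exact Or.inr ⟨Finset.mem_sdiff.mpr ⟨mem_left h1 hx, hm⟩,
          hidx _ _ (T.le_right _ _ rfl) h4⟩)
  refine ⟨nu, ?_, ?_, ?_⟩
  · rw [hnu]
    exact fun b hb => Finset.mem_filter.mpr ⟨hs hb, Or.inl hb⟩
  · rw [hnu]
    exact Finset.filter_subset _ _
  · rintro ⟨b, hb⟩
    have hb' := Finset.mem_sdiff.mp hb
    simp [hnu, I, hb'.1, hb'.2]

/-- Cutting a tableau along the boxes of its largest index. -/
theorem tabCount_add_single {lam mu : StrictPartition} (hs : mu.diagram ⊆ lam.diagram)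
    {e : ℕ →₀ ℕ} {K : ℕ} (he : ∀ k ∈ e.support, k < K) (n : ℕ)
    [Fintype {nu : StrictPartition // mu.diagram ⊆ nu.diagram ∧ nu.diagram ⊆ lam.diagram}] :
    tabCount (lam.diagram \ mu.diagram) (e + Finsupp.single K n) =
      ∑ nu : {nu : StrictPartition // mu.diagram ⊆ nu.diagram ∧ nu.diagram ⊆ lam.diagram},
        tabCount (nu.1.diagram \ mu.diagram) e *
          tabCount (lam.diagram \ nu.1.diagram) (Finsupp.single K n) := by
  classical
  have hfin := ShiftedTableau.finite_content_eq
  have heK : e K = 0 := by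
    by_contra h
    exact lt_irrefl _ (he K (Finsupp.mem_support_iff.mpr h))
  simp only [tabCount, ← Nat.card_prod]
  rw [← Nat.card_sigma]
  symm
  have hres : ∀ (nu : StrictPartition) (h1 : mu.diagram ⊆ nu.diagram)
      (h2 : nu.diagram ⊆ lam.diagram) (S : ShiftedTableau (nu.diagram \ mu.diagram))
      (T : ShiftedTableau (lam.diagram \ nu.diagram)) (hlt : ∀ a b, S.entry a < T.entry b),
      (glueTableau S T hlt).restrict (Finset.sdiff_subset_sdiff h2 subset_rfl) = S ∧
      (glueTableau S T hlt).restrict (Finset.sdiff_subset_sdiff subset_rfl h1) = T := by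
    intro nu h1 h2 S T hlt
    refine ⟨ShiftedTableau.entry_injective (funext fun b => ?_),
      ShiftedTableau.entry_injective (funext fun b => ?_)⟩
    · simp [ShiftedTableau.restrict, glueTableau, (Finset.mem_sdiff.mp b.2).1]
    · simp [ShiftedTableau.restrict, glueTableau, (Finset.mem_sdiff.mp b.2).2]
  refine Nat.card_congr (Equiv.ofBijective (fun p => ⟨glueTableau p.2.1.1 p.2.2.1
    (lt_of_content he p.2.1.2 p.2.2.2), ?_⟩) ⟨?_, ?_⟩)
  · obtain ⟨⟨nu, h1, h2⟩, ⟨S, hS⟩, ⟨T, hT⟩⟩ := p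
    have h3 := hres nu h1 h2 S T (lt_of_content he hS hT)
    rw [← ShiftedTableau.content_restrict_add _ (Finset.sdiff_subset_sdiff h2 subset_rfl)
      (Finset.sdiff_subset_sdiff subset_rfl h1) disjoint_sdiffs (sdiff_union_sdiff h1 h2),
      h3.1, h3.2, hS, hT]
  · rintro ⟨⟨nu, h1, h2⟩, ⟨S, hS⟩, ⟨T, hT⟩⟩ ⟨⟨nu', h1', h2'⟩, ⟨S', hS'⟩, ⟨T', hT'⟩⟩ h
    have hg := congrArg Subtype.val h
    dsimp only at hg
    -- The middle partition is recovered from the boxes whose index is less than `K`.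
    have hmem : ∀ (nu : StrictPartition) (h1 : mu.diagram ⊆ nu.diagram)
        (h2 : nu.diagram ⊆ lam.diagram) (S : ShiftedTableau (nu.diagram \ mu.diagram))
        (T : ShiftedTableau (lam.diagram \ nu.diagram)) (hS : S.content = e)
        (hT : T.content = Finsupp.single K n) (b : ℕ × ℕ), b ∈ nu.diagram ↔ b ∈ mu.diagram ∨
          ∃ h : b ∈ lam.diagram \ mu.diagram,
            ((glueTableau S T (lt_of_content he hS hT)).entry ⟨b, h⟩).index < K := by
      intro nu h1 h2 S T hS hT b
      constructor
      · intro hb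
        by_cases hm : b ∈ mu.diagram
        · exact Or.inl hm
        · refine Or.inr ⟨Finset.mem_sdiff.mpr ⟨h2 hb, hm⟩, ?_⟩
          simp only [glueTableau, hb, dif_pos]
          exact he _ (hS ▸ S.index_mem_support _)
      · rintro (hb | ⟨hb, hlt⟩)
        · exact h1 hb
        · by_contra hn
          simp only [glueTableau, hn, dif_neg, not_false_eq_true] at hlt
          rw [((T.content_eq_single_iff K n).mp hT).1] at hlt
          exact lt_irrefl _ hlt
    have hnu : nu = nu' := by
      apply diagram_injective
      ext b
      rw [hmem nu h1 h2 S T hS hT, hmem nu' h1' h2' S' T' hS' hT', hg]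
    subst hnu
    have h3 := hres nu h1 h2 S T (lt_of_content he hS hT)
    have h4 := hres nu h1 h2 S' T' (lt_of_content he hS' hT')
    rw [hg] at h3
    have hSS : S = S' := h3.1.symm.trans h4.1
    have hTT : T = T' := h3.2.symm.trans h4.2
    subst hSS hTT
    rfl
  · rintro ⟨T, hT⟩
    obtain ⟨nu, h1, h2, h3⟩ := exists_diagram_of_index_lt hs T K
    have hadd := T.content_restrict_add (Finset.sdiff_subset_sdiff h2 subset_rfl)
      (Finset.sdiff_subset_sdiff subset_rfl h1) disjoint_sdiffs (sdiff_union_sdiff h1 h2)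
    set S1 := T.restrict (Finset.sdiff_subset_sdiff h2 (subset_refl mu.diagram)) with hS1
    set S2 := T.restrict (Finset.sdiff_subset_sdiff (subset_refl lam.diagram) h1) with hS2
    have hi1 : ∀ b, (S1.entry b).index < K := fun b =>
      (h3 ⟨b.1, Finset.sdiff_subset_sdiff h2 (subset_refl _) b.2⟩).mp (Finset.mem_sdiff.mp b.2).1
    have hi2 : ∀ b, (S2.entry b).index = K := by
      intro b
      have h4 := (h3 ⟨b.1, Finset.sdiff_subset_sdiff (subset_refl _) h1 b.2⟩).not.mp
        (Finset.mem_sdiff.mp b.2).2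
      have h5 := T.index_mem_support ⟨b.1, Finset.sdiff_subset_sdiff (subset_refl _) h1 b.2⟩
      rw [hT] at h5
      rcases Finset.mem_union.mp (Finsupp.support_add h5) with h6 | h6
      · exact absurd (he _ h6) h4
      · exact Finset.mem_singleton.mp (Finsupp.support_single_subset h6)
    have hc2 : S2.content = Finsupp.single K (lam.diagram \ nu.diagram).card :=
      (S2.content_eq_single_iff _ _).mpr ⟨hi2, rfl⟩
    have hc1K : S1.content K = 0 := by
      rw [ShiftedTableau.content_apply, Finset.card_eq_zero, Finset.filter_eq_empty_iff]
      exact fun b _ => (hi1 b).ne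
    have hcard : (lam.diagram \ nu.diagram).card = n := by
      have := DFunLike.congr_fun (hadd.trans hT) K
      simpa [hc2, hc1K, heK] using this
    rw [hcard] at hc2
    have hc1 : S1.content = e := by
      rw [hT, hc2] at hadd
      exact add_right_cancel hadd
    refine ⟨⟨⟨nu, h1, h2⟩, ⟨S1, hc1⟩, ⟨S2, hc2⟩⟩, Subtype.ext ?_⟩
    refine ShiftedTableau.entry_injective (funext fun b => ?_)
    by_cases hb : b.1 ∈ nu.diagram
    · simp [glueTableau, hb, hS1, ShiftedTableau.restrict]
    · simp [glueTableau, hb, hS2, ShiftedTableau.restrict]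

end StrictPartition

/-! ### The operators on strict partitions with bounded parts -/

namespace StrictPartition

/-- The strict partitions whose parts are at most `N`. -/
abbrev Bounded (N : ℕ) : Type := {nu : StrictPartition // ∀ k, N ≤ k → nu.diagLen k = 0}

/-- Strict partitions with parts at most `N`, encoded by their diagonal lengths. -/
noncomputable def boundedEquiv (N : ℕ) : Bounded N ≃ paths N :=
  Equiv.ofBijective (fun nu => ⟨nu.1.diagSeq, diagSeq_mem_paths nu.2⟩)
    ⟨fun _ _ h => Subtype.ext (diagSeq_injective (congrArg Subtype.val h)), fun u => by
      obtain ⟨nu, h1, h2⟩ := exists_diagSeq_eq u.2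
      exact ⟨⟨nu, h2⟩, Subtype.ext h1⟩⟩

noncomputable instance (N : ℕ) : Fintype (Bounded N) := Fintype.ofEquiv _ (boundedEquiv N).symm

theorem sum_bounded {R : Type*} [AddCommMonoid R] (N : ℕ) (F : (ℕ → ℤ) → R) :
    ∑ nu : Bounded N, F nu.1.diagSeq = ∑ u ∈ paths N, F u := by
  rw [← Finset.sum_coe_sort (paths N) F]
  exact Fintype.sum_equiv (boundedEquiv N) _ _ fun _ => rfl

open Classical in
/-- The operator that adds all border strips of size `n`, weighted by `2` to the number of their
components. -/
noncomputable def ribbonMatrix (N n : ℕ) : Matrix (Bounded N) (Bounded N) ℤ :=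
  Matrix.of fun lam nu =>
    if lam.1.IsRibbon nu.1 ∧ (lam.1.diagram \ nu.1.diagram).card = n then
      2 ^ comp (lam.1.diagram \ nu.1.diagram) else 0

open Classical in
/-- The generating function `∑ ribbonMatrix N n * z ^ n`. -/
noncomputable def ribbonSeries {R : Type*} [CommRing R] (N : ℕ) (z : R) :
    Matrix (Bounded N) (Bounded N) R :=
  Matrix.of fun lam nu => if lam.1.IsRibbon nu.1 then
    2 ^ comp (lam.1.diagram \ nu.1.diagram) * z ^ (lam.1.diagram \ nu.1.diagram).card else 0

theorem ribbonSeries_comm {R : Type*} [CommRing R] (N : ℕ) (x y : R) :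
    ribbonSeries N x * ribbonSeries N y = ribbonSeries N y * ribbonSeries N x := by
  ext lam mu
  simp only [Matrix.mul_apply, ribbonSeries, Matrix.of_apply]
  have h : ∀ (z : R) (a b : Bounded N), _ := fun z a b => fullWeight_diagSeq z a.2 b.2
  simp only [h]
  rw [sum_bounded N fun u => fullWeight x N lam.1.diagSeq u * fullWeight y N u mu.1.diagSeq,
    sum_bounded N fun u => fullWeight y N lam.1.diagSeq u * fullWeight x N u mu.1.diagSeq]
  exact sum_fullWeight_comm x y N _ _ (diagSeq_mem_paths lam.2) (diagSeq_mem_paths mu.2)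

open Polynomial in
/-- Comparing the coefficients of the two variables in the commutation of the generating
functions. -/
theorem ribbonMatrix_comm (N m n : ℕ) : Commute (ribbonMatrix N m) (ribbonMatrix N n) := by
  classical
  have h := ribbonSeries_comm N (C (X : ℤ[X])) (X : ℤ[X][X])
  have h1 : ∀ c a d b : ℕ, ((((2 : ℤ[X][X]) ^ c * C X ^ a) * (2 ^ d * X ^ b)).coeff n).coeff m =
      (if a = m then 2 ^ c else 0) * if b = n then 2 ^ d else 0 := by
    intro c a d b
    have e : ((2 : ℤ[X][X]) ^ c * C X ^ a) * (2 ^ d * X ^ b) =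
        C (C (2 ^ c * 2 ^ d) * X ^ a) * X ^ b := by
      simp only [map_mul, map_pow, map_ofNat]
      ring
    rw [e, coeff_C_mul_X_pow]
    by_cases hb : b = n
    · rw [if_pos hb.symm, coeff_C_mul_X_pow, if_pos hb]
      simp only [eq_comm (a := m)]
      split_ifs <;> simp
    · rw [if_neg (Ne.symm hb), if_neg hb, coeff_zero, mul_zero]
  ext lam mu
  have h2 := congrArg (fun p => (p.coeff n).coeff m) (congrFun (congrFun h lam) mu)
  simp only [Matrix.mul_apply, ribbonSeries, Matrix.of_apply, finsetSum_coeff] at h2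
  have e1 : ∀ (p q : Prop) [Decidable p] [Decidable q] (c a d b : ℕ),
      (((if p then (2 : ℤ[X][X]) ^ c * C X ^ a else 0) *
        if q then 2 ^ d * X ^ b else 0).coeff n).coeff m =
      (if p ∧ a = m then 2 ^ c else 0) * if q ∧ b = n then 2 ^ d else 0 := by
    intro p q _ _ c a d b
    by_cases hp : p <;> by_cases hq : q <;> simp [hp, hq, h1]
  have e2 : ∀ (p q : Prop) [Decidable p] [Decidable q] (c a d b : ℕ),
      (((if p then (2 : ℤ[X][X]) ^ c * X ^ a else 0) *
        if q then 2 ^ d * C X ^ b else 0).coeff n).coeff m =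
      (if p ∧ a = n then 2 ^ c else 0) * if q ∧ b = m then 2 ^ d else 0 := by
    intro p q _ _ c a d b
    rw [mul_comm, e1, mul_comm]
  simp only [e1, e2] at h2
  simpa only [Matrix.mul_apply, ribbonMatrix, Matrix.of_apply] using h2

open Classical in
/-- The coefficients of `x ^ e` in the skew `Q`-functions. -/
noncomputable def skewMatrix (N : ℕ) (e : ℕ →₀ ℕ) : Matrix (Bounded N) (Bounded N) ℤ :=
  Matrix.of fun lam mu => if mu.1.diagram ⊆ lam.1.diagram then
    (tabCount (lam.1.diagram \ mu.1.diagram) e : ℤ) else 0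

theorem skewMatrix_single (N K n : ℕ) :
    skewMatrix N (Finsupp.single K n) = ribbonMatrix N n := by
  classical
  ext lam mu
  simp only [skewMatrix, ribbonMatrix, Matrix.of_apply]
  by_cases hs : mu.1.diagram ⊆ lam.1.diagram
  · rw [if_pos hs]
    by_cases hr : lam.1.IsRibbon mu.1
    · by_cases hn : (lam.1.diagram \ mu.1.diagram).card = n
      · rw [if_pos ⟨hr, hn⟩, ← hn, tabCount_single_of_isStrip hr.isStrip (isLineConvex_sdiff _ _)]
        push_cast
        rfl
      · rw [if_neg fun h => hn h.2, tabCount_single_of_card_ne hn, Nat.cast_zero]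
    · obtain ⟨x, y, h1, h2, h3⟩ := exists_square_of_not_isRibbon hs hr
      rw [if_neg fun h => hr h.1, tabCount_single_eq_zero h1 h2 h3, Nat.cast_zero]
  · rw [if_neg hs, if_neg fun h => hs h.1.1]

theorem diagLen_eq_zero_of_subset {lam nu : StrictPartition} (h : nu.diagram ⊆ lam.diagram) {N : ℕ}
    (hlam : ∀ k, N ≤ k → lam.diagLen k = 0) : ∀ k, N ≤ k → nu.diagLen k = 0 := fun k hk =>
  Nat.le_zero.mp (((subset_iff_diagLen_le lam nu).mp h k).trans (hlam k hk).le)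

theorem skewMatrix_add_single (N : ℕ) {e : ℕ →₀ ℕ} {K : ℕ} (he : ∀ k ∈ e.support, k < K) (n : ℕ) :
    skewMatrix N (e + Finsupp.single K n) = ribbonMatrix N n * skewMatrix N e := by
  classical
  rw [← skewMatrix_single N K]
  ext lam mu
  simp only [skewMatrix, Matrix.mul_apply, Matrix.of_apply]
  by_cases hs : mu.1.diagram ⊆ lam.1.diagram
  · have : Finite {nu : StrictPartition //
        mu.1.diagram ⊆ nu.diagram ∧ nu.diagram ⊆ lam.1.diagram} :=
      (lam.1.finite_subdiagrams.subset fun nu (h : _ ∧ _) => h.2).to_subtype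
    have := Fintype.ofFinite {nu : StrictPartition //
        mu.1.diagram ⊆ nu.diagram ∧ nu.diagram ⊆ lam.1.diagram}
    rw [if_pos hs, tabCount_add_single hs he n, Nat.cast_sum]
    refine Finset.sum_of_injOn
      (fun nu => ⟨nu.1, diagLen_eq_zero_of_subset nu.2.2 lam.2⟩) ?_ ?_ ?_ ?_
    · intro a _ b _ hab
      exact Subtype.ext (congrArg (fun c : Bounded N => c.1) hab)
    · intro a _
      exact Finset.mem_coe.mpr (Finset.mem_univ _)
    · intro nu _ hnu
      by_cases h1 : nu.1.diagram ⊆ lam.1.diagram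
      · by_cases h2 : mu.1.diagram ⊆ nu.1.diagram
        · exact absurd ⟨⟨nu.1, h2, h1⟩, Finset.mem_coe.mpr (Finset.mem_univ _), rfl⟩ hnu
        · rw [if_neg h2, mul_zero]
      · rw [if_neg h1, zero_mul]
    · intro nu _
      rw [if_pos nu.2.2, if_pos nu.2.1, Nat.cast_mul, mul_comm]
  · rw [if_neg hs]
    symm
    refine Finset.sum_eq_zero fun nu _ => ?_
    by_cases h1 : nu.1.diagram ⊆ lam.1.diagram
    · rw [if_neg fun h2 : mu.1.diagram ⊆ nu.1.diagram => hs (h2.trans h1), mul_zero]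
    · rw [if_neg h1, zero_mul]

/-- The `Q`-function operators are products of strip operators, hence commute with them. -/
theorem commute_skewMatrix_ribbonMatrix (N : ℕ) (e : ℕ →₀ ℕ) (n : ℕ) :
    Commute (skewMatrix N e) (ribbonMatrix N n) := by
  induction e using Finsupp.induction_on_max with
  | zero =>
    -- The content `0` is a single index with multiplicity `0`.
    rw [← Finsupp.single_zero 0, skewMatrix_single]
    exact ribbonMatrix_comm N 0 n
  | single_add K m f hf _ ih =>
    rw [add_comm, skewMatrix_add_single N hf]
    exact (ribbonMatrix_comm N m n).mul_left ih

end StrictPartition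

/-! ### The removal formulas -/

namespace StrictPartition

theorem empty_diagram : empty.diagram = ∅ := rfl

theorem mem_row_diagram {n : ℕ} (hn : 1 ≤ n) (x y : ℕ) :
    (x, y) ∈ (row n hn).diagram ↔ x = 1 ∧ 1 ≤ y ∧ y ≤ n := by
  rw [mem_diagram]
  rcases Nat.lt_or_ge 1 x with hx | hx
  · rw [part_eq_zero _ (by simpa [length, row] using hx)]
    omega
  · rcases Nat.lt_or_ge 0 x with h0 | h0
    · obtain rfl : x = 1 := by omega
      have : (row n hn).part 1 = n := rfl
      omega
    · omega

theorem row_diagram {n : ℕ} (hn : 1 ≤ n) : (row n hn).diagram = {1} ×ˢ Finset.Icc 1 n := by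
  ext ⟨x, y⟩
  rw [mem_row_diagram, Finset.mem_product, Finset.mem_singleton, Finset.mem_Icc]

theorem row_diagram_card {n : ℕ} (hn : 1 ≤ n) : (row n hn).diagram.card = n := by
  simp [row_diagram]

theorem row_subset {lam : StrictPartition} {n : ℕ} (hn : 1 ≤ n) (h : n ≤ lam.part 1) :
    (row n hn).diagram ⊆ lam.diagram := by
  rintro ⟨x, y⟩ hb
  rw [mem_row_diagram] at hb
  rw [mem_diagram]
  obtain ⟨rfl, h1, h2⟩ := hb
  omega

theorem isRibbon_empty_iff {nu : StrictPartition} {n : ℕ} (hn : 1 ≤ n) :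
    nu.IsRibbon empty ∧ (nu.diagram \ empty.diagram).card = n ↔ nu = row n hn := by
  rw [empty_diagram, Finset.sdiff_empty]
  constructor
  · rintro ⟨h, hc⟩
    have h2 : ∀ x y, (x, y) ∈ nu.diagram → x = 1 := by
      intro x y hb
      have hp := pos_of_mem hb
      by_contra hx
      have h1 : (1, 1) ∈ nu.diagram := mem_of_le hb le_rfl hp.1 le_rfl (by omega)
      have h3 : (1 + 1, 1 + 1) ∈ nu.diagram := mem_of_le hb (by omega) (by omega) le_rfl (by omega)
      exact (mem_border.mp (h.2 (by simpa [empty_diagram] using h1))).2 h3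
    have h3 : nu.diagram = {1} ×ˢ Finset.Icc 1 (nu.part 1) := by
      ext ⟨x, y⟩
      simp only [Finset.mem_product, Finset.mem_singleton, Finset.mem_Icc]
      constructor
      · intro hb
        obtain rfl := h2 _ _ hb
        rw [mem_diagram] at hb
        omega
      · rintro ⟨rfl, hb⟩
        rw [mem_diagram]
        omega
    have h4 : nu.part 1 = n := by
      rw [← hc, h3]
      simp
    apply diagram_injective
    rw [h3, h4, row_diagram]
  · rintro rfl
    refine ⟨⟨by simp [empty_diagram], ?_⟩, row_diagram_card hn⟩
    rintro ⟨x, y⟩ hb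
    have hb' := (Finset.mem_sdiff.mp hb).1
    rw [mem_border]
    refine ⟨hb', fun h => ?_⟩
    rw [mem_row_diagram] at hb' h
    omega

theorem comp_row {n : ℕ} (hn : 1 ≤ n) : comp ((row n hn).diagram \ empty.diagram) = 1 := by
  have h := ((isRibbon_empty_iff hn).mpr rfl).1
  rw [comp_eq_card_lastBoxes h.isStrip, Finset.card_eq_one]
  refine ⟨(1, 1), ?_⟩
  ext ⟨x, y⟩
  rw [mem_lastBoxes, empty_diagram, Finset.sdiff_empty]
  simp only [IsLastBox, mem_row_diagram, Finset.mem_singleton, Prod.mk.injEq]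
  omega

theorem ribbonMatrix_empty {N n : ℕ} (hn : 1 ≤ n) (nu E : Bounded N) (hE : E.1 = empty)
    [Decidable (nu.1 = row n hn)] :
    ribbonMatrix N n nu E = if nu.1 = row n hn then 2 else 0 := by
  classical
  simp only [ribbonMatrix, Matrix.of_apply, hE, isRibbon_empty_iff hn]
  split_ifs with h
  · rw [h, comp_row, pow_one]
  · rfl

theorem mem_borderRemovals {lam nu : StrictPartition} {n : ℕ} : nu ∈ lam.borderRemovals n ↔
    lam.IsRibbon nu ∧ (lam.diagram \ nu.diagram).card = n := by
  simp only [borderRemovals, IsRibbon, Set.mem_ofPred_eq, and_assoc]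

/-- Both sides of the commutation relation evaluated between `lam` and the empty partition, from
which the strip operator of size `n` only reaches the row `(n)`. -/
theorem two_mul_tabCount_row (lam : StrictPartition) {n : ℕ} (hn : 1 ≤ n) (h : n ≤ lam.part 1)
    (e : ℕ →₀ ℕ) :
    2 * (tabCount (lam.diagram \ (row n hn).diagram) e : ℤ) =
      ∑ nu ∈ (lam.borderRemovals_finite n).toFinset,
        2 ^ comp (lam.diagram \ nu.diagram) * (tabCount nu.diagram e : ℤ) := by
  classical
  have hlam : ∀ k, lam.part 1 ≤ k → lam.diagLen k = 0 := fun k hk => lam.diagLen_eq_zero hk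
  let L : Bounded (lam.part 1) := ⟨lam, hlam⟩
  let E : Bounded (lam.part 1) := ⟨empty, diagLen_eq_zero_of_subset (by simp [empty_diagram]) hlam⟩
  let S : Bounded (lam.part 1) := ⟨row n hn, diagLen_eq_zero_of_subset (row_subset hn h) hlam⟩
  have hU : ∀ nu, ribbonMatrix (lam.part 1) n L nu =
      if lam.IsRibbon nu.1 ∧ (lam.diagram \ nu.1.diagram).card = n then
        2 ^ comp (lam.diagram \ nu.1.diagram) else 0 := fun _ => rfl
  have hE : ∀ nu, skewMatrix (lam.part 1) e nu E = tabCount nu.1.diagram e := fun nu => by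
    simp only [skewMatrix, Matrix.of_apply]
    rw [show E.1.diagram = ∅ from rfl, if_pos (Finset.empty_subset _), Finset.sdiff_empty]
  have key := congrFun (congrFun (commute_skewMatrix_ribbonMatrix (lam.part 1) e n).eq L) E
  rw [Matrix.mul_apply, Matrix.mul_apply] at key
  have hl : ∑ nu, skewMatrix (lam.part 1) e L nu * ribbonMatrix (lam.part 1) n nu E =
      2 * (tabCount (lam.diagram \ (row n hn).diagram) e : ℤ) := by
    rw [Finset.sum_eq_single S]
    · rw [ribbonMatrix_empty hn S E rfl, if_pos rfl, mul_comm]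
      congr 1
      exact if_pos (row_subset hn h)
    · intro nu _ hnu
      rw [ribbonMatrix_empty hn nu E rfl, if_neg fun hc => hnu (Subtype.ext hc), mul_zero]
    · exact fun hS => absurd (Finset.mem_univ _) hS
  rw [← hl, key]
  symm
  refine Finset.sum_bij_ne_zero (fun nu hnu _ => ⟨nu, diagLen_eq_zero_of_subset
    (mem_borderRemovals.mp ((Set.Finite.mem_toFinset _).mp hnu)).1.1 hlam⟩) ?_ ?_ ?_ ?_
  · exact fun _ _ _ => Finset.mem_univ _
  · exact fun a _ _ b _ _ hab => congrArg (fun c : Bounded (lam.part 1) => c.1) hab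
  · intro nu _ hne
    have h1 := left_ne_zero_of_mul hne
    have h2 : lam.IsRibbon nu.1 ∧ (lam.diagram \ nu.1.diagram).card = n := by
      by_contra hc
      exact h1 (by rw [hU, if_neg hc])
    refine ⟨nu.1, (Set.Finite.mem_toFinset _).mpr (mem_borderRemovals.mpr h2), ?_, rfl⟩
    rwa [hU, if_pos h2, hE] at hne
  · intro nu hnu _
    have h2 := mem_borderRemovals.mp ((Set.Finite.mem_toFinset _).mp hnu)
    rw [hU, if_pos h2, hE]

theorem coeff_diagramQ (D : Finset (ℕ × ℕ)) (e : ℕ →₀ ℕ) :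
    MvPowerSeries.coeff e (diagramQ D) = tabCount D e := rfl

theorem skewQ_row_eq (lam : StrictPartition) (n : ℕ) (hn : 1 ≤ n) (h : n ≤ lam.part 1) :
    lam.skewQ (row n hn) = ∑ᶠ nu ∈ lam.borderRemovals n,
      (2 : ℤ) ^ (comp (lam.diagram \ nu.diagram) - 1) • nu.schurQ := by
  rw [finsum_mem_eq_finite_toFinset_sum _ (lam.borderRemovals_finite n), skewQ,
    if_pos (row_subset hn h)]
  ext e
  rw [map_sum, coeff_diagramQ]
  -- Each exponent `comp (lam / nu)` is positive because `n` is, so the factor `2` can be cancelled.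
  refine mul_left_cancel₀ (two_ne_zero (α := ℤ)) ?_
  rw [two_mul_tabCount_row lam hn h, Finset.mul_sum]
  refine Finset.sum_congr rfl fun nu hnu => ?_
  obtain ⟨hr, hc⟩ := mem_borderRemovals.mp ((Set.Finite.mem_toFinset _).mp hnu)
  have hpos := hr.comp_pos (Finset.card_pos.mp (by omega))
  rw [schurQ_eq, map_smul, coeff_diagramQ, smul_eq_mul, ← mul_assoc, ← pow_succ',
    Nat.sub_add_cancel hpos]

theorem cornerRemovals_eq (lam : StrictPartition) :
    lam.cornerRemovals = lam.borderRemovals 1 := by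
  ext nu
  rw [mem_borderRemovals, Finset.card_eq_one]
  constructor
  · rintro ⟨⟨x, y⟩, ⟨h1, h2, h3⟩, h4⟩
    have h5 : lam.diagram \ nu.diagram = {(x, y)} := by
      rw [h4]
      ext b
      simp only [Finset.mem_sdiff, Finset.mem_erase, Finset.mem_singleton]
      refine ⟨by tauto, ?_⟩
      rintro rfl
      exact ⟨h1, by simp⟩
    refine ⟨⟨?_, ?_⟩, _, h5⟩
    · rw [h4]
      exact Finset.erase_subset _ _
    · rw [h5, Finset.singleton_subset_iff, mem_border]
      exact ⟨h1, fun hc => h3 (mem_up hc (pos_of_mem h1).1)⟩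
  · rintro ⟨hr, ⟨x, y⟩, hb⟩
    have hmem : ∀ c, c ∈ lam.diagram ∧ c ∉ nu.diagram ↔ c = (x, y) := fun c => by
      rw [← Finset.mem_sdiff, hb, Finset.mem_singleton]
    obtain ⟨h1, h2⟩ := (hmem (x, y)).mpr rfl
    have hp := pos_of_mem h1
    refine ⟨(x, y), ⟨h1, fun hc => ?_, fun hc => ?_⟩, ?_⟩
    · by_cases h3 : (x + 1, y) ∈ nu.diagram
      · exact h2 (mem_up h3 hp.1)
      · simpa using (hmem _).mp ⟨hc, h3⟩
    · by_cases h3 : (x, y + 1) ∈ nu.diagram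
      · exact h2 (mem_left h3 hp.2)
      · simpa using (hmem _).mp ⟨hc, h3⟩
    · ext c
      rw [Finset.mem_erase, Ne, ← hmem]
      have := @hr.1 c
      tauto

theorem comp_of_card_eq_one {lam nu : StrictPartition} (hr : lam.IsRibbon nu)
    (hc : (lam.diagram \ nu.diagram).card = 1) : comp (lam.diagram \ nu.diagram) = 1 := by
  have h1 := hr.comp_pos (Finset.card_pos.mp (by omega))
  have h2 : (lastBoxes (lam.diagram \ nu.diagram)).card ≤ (lam.diagram \ nu.diagram).card :=
    Finset.card_le_card fun b hb => (mem_lastBoxes.mp hb).1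
  rw [← comp_eq_card_lastBoxes hr.isStrip] at h2
  omega

theorem skewQ_row_one_eq (lam : StrictPartition) :
    lam.skewQ (row 1 le_rfl) = ∑ᶠ nu ∈ lam.cornerRemovals, nu.schurQ := by
  rw [cornerRemovals_eq]
  by_cases h : 1 ≤ lam.part 1
  · rw [skewQ_row_eq lam 1 le_rfl h]
    refine finsum_mem_congr rfl fun nu hnu => ?_
    obtain ⟨hr, hc⟩ := mem_borderRemovals.mp hnu
    rw [comp_of_card_eq_one hr hc]
    simp
  -- For the empty partition both sides vanish.
  · have hD : ∀ b, b ∉ lam.diagram := by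
      rintro ⟨x, y⟩ hb
      have hp := pos_of_mem hb
      have := (lam.mem_diagram 1 1).mp (mem_of_le hb le_rfl hp.1 le_rfl (by omega))
      omega
    rw [skewQ, if_neg fun hs => hD (1, 1) (hs ((mem_row_diagram _ _ _).mpr (by omega)))]
    symm
    refine finsum_mem_eq_zero_of_forall_eq_zero fun nu hnu => ?_
    obtain ⟨b, hb⟩ := Finset.card_pos.mp
      (Nat.lt_of_lt_of_eq Nat.zero_lt_one (mem_borderRemovals.mp hnu).2.symm)
    exact absurd (Finset.mem_sdiff.mp hb).1 (hD b)

end StrictPartition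

/-! ### Removing all but one box of the border -/

namespace StrictPartition

theorem mem_border_iff {lam : StrictPartition} {x y : ℕ} : (x, y) ∈ lam.border ↔
    x ≤ y ∧ x = lam.diagLen (y - x) ∧ 0 < lam.diagLen (y - x) := by
  rw [mem_border, mem_iff_le_diagLen', mem_iff_le_diagLen',
    show y + 1 - (x + 1) = y - x by omega]
  omega

theorem border_subset (lam : StrictPartition) : lam.border ⊆ lam.diagram :=
  Finset.filter_subset _ _

theorem exists_diagram_eq_sdiff_border (lam : StrictPartition) :
    ∃ mu : StrictPartition, mu.diagram = lam.diagram \ lam.border := by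
  have hm : ∀ x y, (x, y) ∈ lam.diagram \ lam.border ↔ 1 ≤ x ∧ (x + 1, y + 1) ∈ lam.diagram := by
    intro x y
    rw [Finset.mem_sdiff, mem_border, not_and, not_not]
    exact ⟨fun h => ⟨(pos_of_mem h.1).1, h.2 h.1⟩, fun h => ⟨mem_diag h.2 h.1, fun _ => h.2⟩⟩
  refine exists_diagram_eq _ (fun x y h => pos_of_mem (Finset.mem_sdiff.mp h).1)
    (fun x y h hx => ?_) (fun x y h hx => ?_)
  · rw [hm] at h ⊢
    exact ⟨hx, mem_up h.2 (by omega)⟩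
  · rw [hm] at h ⊢
    exact ⟨h.1, mem_left h.2 (by omega)⟩

theorem exists_diagram_eq_union {lam mu : StrictPartition}
    (hmu : mu.diagram = lam.diagram \ lam.border) {b : ℕ × ℕ} (hb : b ∈ lam.borderTimes) :
    ∃ nu : StrictPartition, nu.diagram = mu.diagram ∪ {b} := by
  obtain ⟨hb1, hb2, hb3⟩ := Finset.mem_filter.mp hb
  have hbl := lam.border_subset hb1
  refine exists_diagram_eq _ (fun x y h => ?_) (fun x y h hx => ?_) (fun x y h hx => ?_)
  · rcases Finset.mem_union.mp h with h | h
    · exact pos_of_mem h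
    · rw [← Finset.mem_singleton.mp h] at hbl
      exact pos_of_mem hbl
  · refine Finset.mem_union_left _ ?_
    rcases Finset.mem_union.mp h with h | h
    · exact mem_up h hx
    · rw [← Finset.mem_singleton.mp h] at hb2 hbl
      rw [hmu]
      exact Finset.mem_sdiff.mpr ⟨mem_up hbl hx, hb2⟩
  · refine Finset.mem_union_left _ ?_
    rcases Finset.mem_union.mp h with h | h
    · exact mem_left h hx
    · rw [← Finset.mem_singleton.mp h] at hb3 hbl
      rw [hmu]
      exact Finset.mem_sdiff.mpr ⟨mem_left hbl hx, hb3⟩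

theorem sdiff_eq_border_erase {lam mu : StrictPartition}
    (hmu : mu.diagram = lam.diagram \ lam.border) {nu : StrictPartition} {b : ℕ × ℕ}
    (hnu : nu.diagram = mu.diagram ∪ {b}) : lam.diagram \ nu.diagram = lam.border.erase b := by
  rw [hnu, hmu]
  ext c
  have := @border_subset lam c
  simp only [Finset.mem_sdiff, Finset.mem_union, Finset.mem_singleton, Finset.mem_erase]
  tauto

theorem isRibbon_of_eq_union {lam mu : StrictPartition}
    (hmu : mu.diagram = lam.diagram \ lam.border) {nu : StrictPartition} {b : ℕ × ℕ}
    (hb : b ∈ lam.border)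
    (hnu : nu.diagram = mu.diagram ∪ {b}) : lam.IsRibbon nu := by
  refine ⟨?_, ?_⟩
  · rw [hnu, hmu]
    exact Finset.union_subset Finset.sdiff_subset
      (Finset.singleton_subset_iff.mpr (lam.border_subset hb))
  · rw [sdiff_eq_border_erase hmu hnu]
    exact Finset.erase_subset _ _

theorem card_border {lam mu : StrictPartition}
    (hmu : mu.diagram = lam.diagram \ lam.border) :
    lam.border.card = lam.part 1 := by
  have h1 : lam.diagram \ mu.diagram = lam.border := by
    rw [hmu, Finset.sdiff_sdiff_eq_self lam.border_subset]
  have hr : lam.IsRibbon mu := ⟨by rw [hmu]; exact Finset.sdiff_subset, h1.le⟩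
  rw [← h1, hr.card_eq (lam.diagLen_eq_zero le_rfl), ribbonDiagonals, Finset.filter_true_of_mem,
    Finset.card_range]
  intro k hk
  have hp := lam.diagLen_pos (Finset.mem_range.mp hk)
  have h2 : (lam.diagLen k, lam.diagLen k + k) ∈ lam.diagram \ mu.diagram := by
    rw [h1, mem_border_iff, Nat.add_sub_cancel_left]
    exact ⟨Nat.le_add_right _ _, rfl, hp⟩
  rw [hr.mem_iff, Nat.add_sub_cancel_left] at h2
  exact h2.2.2

theorem exists_borderTimes_of_mem {lam mu : StrictPartition}
    (hmu : mu.diagram = lam.diagram \ lam.border) {nu : StrictPartition}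
    (hnu : nu ∈ lam.borderRemovals (lam.part 1 - 1)) (h1 : 1 ≤ lam.part 1) :
    ∃ b ∈ lam.borderTimes, nu.diagram = mu.diagram ∪ {b} := by
  obtain ⟨hr, hc⟩ := mem_borderRemovals.mp hnu
  have hcard : (lam.border \ (lam.diagram \ nu.diagram)).card = 1 := by
    rw [Finset.card_sdiff_of_subset hr.2, hc, card_border hmu]
    omega
  obtain ⟨⟨x, y⟩, hb⟩ := Finset.card_eq_one.mp hcard
  have hmem : ∀ c, c ∈ lam.border ∧ c ∈ nu.diagram ↔ c = (x, y) := fun c => by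
    have h2 := @border_subset lam c
    rw [← Finset.mem_singleton, ← hb, Finset.mem_sdiff, Finset.mem_sdiff]
    tauto
  obtain ⟨h2, h3⟩ := (hmem (x, y)).mpr rfl
  have hp := pos_of_mem h3
  refine ⟨(x, y), Finset.mem_filter.mpr ⟨h2, fun h => ?_, fun h => ?_⟩, ?_⟩
  · have hp' := pos_of_mem (lam.border_subset h)
    have := (hmem _).mp ⟨h, mem_of_le h3 hp'.1 (Nat.sub_le _ _) hp'.2 le_rfl⟩
    rw [Prod.mk.injEq] at this
    dsimp only at *
    omega
  · have hp' := pos_of_mem (lam.border_subset h)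
    have := (hmem _).mp ⟨h, mem_of_le h3 hp'.1 le_rfl hp'.2 (Nat.sub_le _ _)⟩
    rw [Prod.mk.injEq] at this
    dsimp only at *
    omega
  · rw [hmu]
    ext c
    rw [Finset.mem_union, Finset.mem_sdiff, Finset.mem_singleton, ← hmem]
    constructor
    · intro h
      by_cases hB : c ∈ lam.border
      · exact Or.inr ⟨hB, h⟩
      · exact Or.inl ⟨hr.1 h, hB⟩
    · rintro (⟨h4, h5⟩ | ⟨-, h⟩)
      · by_contra h6
        exact h5 (hr.2 (Finset.mem_sdiff.mpr ⟨h4, h6⟩))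
      · exact h

/-- The border has one box on each of the diagonals `0, …, lam.part 1 - 1`. Erasing the box on
diagonal `k` leaves a component beginning on diagonal `0` unless `k = 0`, and one beginning on
diagonal `k + 1` unless `k` is the last diagonal. -/
theorem two_pow_comp_eq_borderCoeff {lam mu : StrictPartition}
    (hmu : mu.diagram = lam.diagram \ lam.border) {nu : StrictPartition} {b : ℕ × ℕ}
    (hb : b ∈ lam.borderTimes) (hnu : nu.diagram = mu.diagram ∪ {b}) (h1 : 1 ≤ lam.part 1 - 1) :
    (2 : ℤ) ^ (comp (lam.diagram \ nu.diagram) - 1) = lam.borderCoeff b := by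
  classical
  obtain ⟨x, y⟩ := b
  obtain ⟨hb1, hb2, hb3⟩ := Finset.mem_filter.mp hb
  have hr := isRibbon_of_eq_union hmu hb1 hnu
  have hN := lam.diagLen_eq_zero (le_refl (lam.part 1))
  obtain ⟨hxy, hx, hpos⟩ := mem_border_iff.mp hb1
  obtain ⟨k, rfl⟩ := Nat.exists_eq_add_of_le hxy
  rw [Nat.add_sub_cancel_left] at hx hpos
  have hkN : k < lam.part 1 := by
    by_contra hk
    have := lam.diagLen_eq_zero (not_lt.mp hk)
    omega
  have hlt : ∀ j, nu.diagLen j < lam.diagLen j ↔ j < lam.part 1 ∧ j ≠ k := by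
    intro j
    have h2 := hr.mem_iff (lam.diagLen j) (lam.diagLen j + j)
    rw [sdiff_eq_border_erase hmu hnu, Finset.mem_erase, mem_border_iff,
      Nat.add_sub_cancel_left, Ne, Prod.mk.injEq] at h2
    have h3 := lam.diagLen_eq_zero (k := j)
    have h4 := lam.diagLen_pos (k := j)
    by_cases hjk : j = k
    · subst hjk
      omega
    · omega
  have hfilter : ((lam.ribbonDiagonals nu (lam.part 1)).filter
      fun j => j = 0 ∨ nu.diagLen (j - 1) = lam.diagLen (j - 1)) =
      (Finset.range (lam.part 1)).filter fun j => j ≠ k ∧ (j = 0 ∨ j = k + 1) := by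
    ext j
    have h2 := (lam.isRibbon_iff nu).mp hr (j - 1)
    have h3 := hlt (j - 1)
    rw [Finset.mem_filter, Finset.mem_filter, mem_ribbonDiagonals hN, hlt, Finset.mem_range]
    omega
  have hfirst : IsFirstBox lam.border (x, x + k) ↔ k = lam.part 1 - 1 := by
    have h2 := lam.diagLen_succ_le k
    have h3 := lam.diagLen_le_succ k
    have h4 : (x, x + k + 1) ∈ lam.border ↔ lam.diagLen (k + 1) = lam.diagLen k := by
      rw [mem_border_iff, show x + k + 1 - x = k + 1 by omega]
      omega
    have h5 : k < lam.part 1 - 1 → lam.diagLen (k + 1) = lam.diagLen k := by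
      intro h6
      have h7 := lam.diagLen_pos (k := k + 1) (by omega)
      by_contra h8
      refine hb2 (mem_border_iff.mpr ?_)
      dsimp only
      rw [show x + k - (x - 1) = k + 1 by omega]
      omega
    have h6 := lam.diagLen_eq_zero (k := k + 1)
    simp only [IsFirstBox, h4]
    constructor
    · rintro ⟨-, -, h7⟩
      omega
    · intro h7
      exact ⟨hb1, hb2, by omega⟩
  have hlast : IsLastBox lam.border (x, x + k) ↔ k = 0 := by
    simp only [IsLastBox]
    constructor
    · rintro ⟨-, h2, h3⟩
      by_contra hk
      obtain ⟨j, rfl⟩ := Nat.exists_eq_succ_of_ne_zero hk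
      have h4 := lam.diagLen_succ_le j
      have h5 := lam.diagLen_le_succ j
      rw [mem_border_iff, show x + (j + 1) - (x + 1) = j by omega] at h2
      rw [mem_border_iff, show x + (j + 1) - 1 - x = j by omega] at h3
      simp only [Nat.succ_eq_add_one] at *
      omega
    · rintro rfl
      refine ⟨hb1, fun h => ?_, hb3⟩
      have := pos_of_mem (lam.border_subset h)
      omega
  rw [hr.comp_eq hN, hfilter, borderCoeff, hfirst, hlast]
  by_cases hk0 : k = 0
  · have h2 : ((Finset.range (lam.part 1)).filter fun j => j ≠ k ∧ (j = 0 ∨ j = k + 1)) = {1} := by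
      ext j
      rw [Finset.mem_filter, Finset.mem_range, Finset.mem_singleton]
      omega
    rw [h2, if_pos (Or.inr hk0), Finset.card_singleton, Nat.sub_self, pow_zero]
  · by_cases hkN' : k = lam.part 1 - 1
    · have h2 : ((Finset.range (lam.part 1)).filter
          fun j => j ≠ k ∧ (j = 0 ∨ j = k + 1)) = {0} := by
        ext j
        rw [Finset.mem_filter, Finset.mem_range, Finset.mem_singleton]
        omega
      rw [h2, if_pos (Or.inl hkN'), Finset.card_singleton, Nat.sub_self, pow_zero]
    · have h2 : ((Finset.range (lam.part 1)).filter
          fun j => j ≠ k ∧ (j = 0 ∨ j = k + 1)) = {0, k + 1} := by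
        ext j
        rw [Finset.mem_filter, Finset.mem_range, Finset.mem_insert, Finset.mem_singleton]
        omega
      rw [h2, if_neg (by omega), Finset.card_pair (by omega)]
      norm_num

theorem skewQ_row_part_sub_one_eq {lam mu : StrictPartition}
    (hmu : mu.diagram = lam.diagram \ lam.border) (h1 : 1 ≤ lam.part 1 - 1) :
    lam.skewQ (row (lam.part 1 - 1) h1) =
      ∑ b ∈ lam.borderTimes, lam.borderCoeff b • diagramQ (mu.diagram ∪ {b}) := by
  rw [skewQ_row_eq lam _ h1 (Nat.sub_le _ _),
    finsum_mem_eq_finite_toFinset_sum _ (lam.borderRemovals_finite _)]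
  symm
  choose nu hnu using fun b hb => exists_diagram_eq_union hmu (b := b) hb
  have hborder : ∀ b ∈ lam.borderTimes, b ∈ lam.border := fun b hb => (Finset.mem_filter.mp hb).1
  refine Finset.sum_bij nu ?_ ?_ ?_ ?_
  · intro b hb
    rw [Set.Finite.mem_toFinset, mem_borderRemovals, sdiff_eq_border_erase hmu (hnu b hb),
      Finset.card_erase_of_mem (hborder b hb), card_border hmu]
    exact ⟨isRibbon_of_eq_union hmu (hborder b hb) (hnu b hb), rfl⟩
  · intro a ha b hb hab
    have h2 : a ∈ mu.diagram ∪ {b} := by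
      rw [← hnu b hb, ← hab, hnu a ha]
      exact Finset.mem_union_right _ (Finset.mem_singleton_self a)
    rcases Finset.mem_union.mp h2 with h3 | h3
    · rw [hmu] at h3
      exact absurd (hborder a ha) (Finset.mem_sdiff.mp h3).2
    · exact Finset.mem_singleton.mp h3
  · intro ka hka
    obtain ⟨b, hb, hk⟩ := exists_borderTimes_of_mem hmu ((Set.Finite.mem_toFinset _).mp hka)
      (by omega)
    exact ⟨b, hb, diagram_injective ((hnu b hb).trans hk.symm)⟩
  · intro b hb
    rw [two_pow_comp_eq_borderCoeff hmu hb (hnu b hb) h1, schurQ_eq, hnu b hb]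

end StrictPartition

theorem mainTheorem5 (lam : StrictPartition) :
    (∀ (n : ℕ) (hn : 1 ≤ n), n ≤ lam.part 1 →
      lam.skewQ (StrictPartition.row n hn) =
        ∑ᶠ nu ∈ lam.borderRemovals n,
          (2 : ℤ) ^ (comp (lam.diagram \ nu.diagram) - 1) • nu.schurQ) ∧
    (∀ hn : 1 ≤ lam.part 1 - 1,
      ∃ mu : StrictPartition, mu.diagram = lam.diagram \ lam.border ∧
        (∀ b ∈ lam.borderTimes, ∃ nu : StrictPartition, nu.diagram = mu.diagram ∪ {b}) ∧
        lam.skewQ (StrictPartition.row (lam.part 1 - 1) hn) =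
          ∑ b ∈ lam.borderTimes, lam.borderCoeff b • diagramQ (mu.diagram ∪ {b})) ∧
    lam.skewQ (StrictPartition.row 1 le_rfl) = ∑ᶠ nu ∈ lam.cornerRemovals, nu.schurQ := by
  refine ⟨fun n hn h => lam.skewQ_row_eq n hn h, fun hn => ?_, lam.skewQ_row_one_eq⟩
  obtain ⟨mu, hmu⟩ := lam.exists_diagram_eq_sdiff_border
  exact ⟨mu, hmu, fun b hb => StrictPartition.exists_diagram_eq_union hmu hb,
    StrictPartition.skewQ_row_part_sub_one_eq hmu hn⟩
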